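/- A deterministic visibly push-down automaton (DVPDA) $M$ consists of a finite non-empty set $Q$ of states, a finite input alphabet $\Sigma$ that is the disjoint union of sets $\Sigma_{\mathrm{call}}$, $\Sigma_{\mathrm{int}}$ and $\Sigma_{\mathrm{ret}}$, a finite stack alphabet $\Gamma$ with a bottom symbol $\bot\in\Gamma$, and total transition functions $\delta_c\colon Q\times\Sigma_{\mathrm{call}}\to Q\times(\Gamma\setminus\{\bot\})$, $\delta_i\colon Q\times\Sigma_{\mathrm{int}}\to Q$ and $\delta_r\colon Q\times\Sigma_{\mathrm{ret}}\times\Gamma\to Q$. A call letter changes the state and pushes a symbol, as given by $\delta_c$; an internal letter changes only the state, as given by $\delta_i$; a return letter changes the state according to $\delta_r$, depending on the top symbol of the stack, and pops this symbol unless it is $\bot$ ($\bot$ is only read). For $q\in Q$ and $w\in\Sigma^*$ let $(q,\bot)\xrightarrow{w}(q',\upsilon)$ mean that the run on $w$ that starts in state $q$ with stack content $\bot$ ends in state $q'$ with stack content $\upsilon$. A word $w\in\Sigma^*$ synchronizes $M$ in the same stack model if there are $\overline q\in Q$ and $\upsilon\in\Gamma^*$ such that $(q,\bot)\xrightarrow{w}(\overline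 q,\upsilon)$ for all $q\in Q$. It synchronizes $M$ in the empty stack model if there is $\overline q\in Q$ such that $(q,\bot)\xrightarrow{w}(\overline q,\bot)$ for all $q\in Q$. Theorem. The problem Sync-DVPDA-Same-Return is in $\mathsf{P}$: given a DVPDA $M$ with $\Sigma_{\mathrm{ret}}\neq\emptyset$ (encoded by the sizes of its state set and alphabets and by its complete transition tables), it can be decided by a Turing machine in time polynomial in the length of the input whether there is a word that synchronizes $M$ in the same stack model. Moreover, for every DVPDA $M$ with $\Sigma_{\mathrm{ret}}\neq\emptyset$, there is a word that synchronizes $M$ in the same stack model if and only if there is a word that synchronizes $M$ in the empty stack model. -/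

import Mathlib

/-- The input alphabet of a visibly push-down automaton: the disjoint union of a set `C` of call
letters, a set `I` of internal letters and a set `R` of return letters. -/
inductive Letter (C I R : Type*) where
  | call (a : C)
  | int (a : I)
  | ret (a : R)

/-- A (complete, real-time) deterministic visibly push-down automaton without start and final
states. The set of states is `Q`, the input alphabet is `Letter C I R`, and the stack alphabet is
`Γ = WithBot G`: the bottom symbol `⊥` together with the set `G = Γ ∖ {⊥}`. -/
structure DVPDA (Q C I R G : Type*) where
  /-- a call letter changes the state and pushes a symbol other than `⊥` -/
  δc : Q → C → Q × G
  /-- an internal letter changes the state only -/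
  δi : Q → I → Q
  /-- a return letter reads the top of the stack -/
  δr : Q → R → WithBot G → Q

namespace DVPDA

variable {Q C I R G : Type*}

/-- One transition. A configuration is a state with a stack content; the head of the list is the
top of the stack. A return letter pops the top symbol, except that `⊥` is only read. On a stack
from which even `⊥` is missing there is no transition (such a stack never occurs in a run that
starts in a configuration `(q, [⊥])`). -/
def step (M : DVPDA Q C I R G) : Q × List (WithBot G) → Letter C I R → Option (Q × List (WithBot G))
  | (_, []), _ => none
  | (q, γ :: s), .call a => some ((M.δc q a).1, ((M.δc q a).2 : WithBot G) :: γ :: s)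
  | (q, γ :: s), .int a => some (M.δi q a, γ :: s)
  | (q, ⊥ :: s), .ret a => some (M.δr q a ⊥, ⊥ :: s)
  | (q, (γ : G) :: s), .ret a => some (M.δr q a γ, s)

/-- The configuration reached by reading a word. -/
def run (M : DVPDA Q C I R G) (c : Q × List (WithBot G)) (w : List (Letter C I R)) :
    Option (Q × List (WithBot G)) :=
  w.foldlM M.step c

/-- The word `w` synchronizes `M` in the same stack model: all the runs that start in some state
with the stack `⊥` end in one common state with one common stack content. -/
def SyncSame (M : DVPDA Q C I R G) (w : List (Letter C I R)) : Prop :=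
  ∃ (p : Q) (s : List (WithBot G)), ∀ q : Q, M.run (q, [⊥]) w = some (p, s)

/-- The word `w` synchronizes `M` in the empty stack model: all the runs that start in some state
with the stack `⊥` end in one common state with the stack `⊥`. -/
def SyncEmpty (M : DVPDA Q C I R G) (w : List (Letter C I R)) : Prop :=
  ∃ p : Q, ∀ q : Q, M.run (q, [⊥]) w = some (p, [⊥])

end DVPDA

/-- A DVPDA as the input of an algorithm: the elements of its (finite) sets of states, call letters,
internal letters, return letters and non-bottom stack symbols are numbered. -/
structure DVPDAInstance where
  /-- number of states -/
  n : ℕ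
  /-- number of call letters -/
  c : ℕ
  /-- number of internal letters -/
  i : ℕ
  /-- number of return letters -/
  r : ℕ
  /-- number of stack symbols other than `⊥` -/
  g : ℕ
  n_pos : 0 < n
  M : DVPDA (Fin n) (Fin c) (Fin i) (Fin r) (Fin g)

/-- A list of numbers as a binary word: the number `m` is written as `m` ones and a zero. -/
def encodeNats (l : List ℕ) : List Bool :=
  l.flatMap fun m => List.replicate m true ++ [false]

namespace DVPDAInstance

/-- The numbers that describe an instance: the five sizes, and then the complete tables of the three
transition functions, in lexicographic order of the arguments (with `⊥` as the first stack
symbol). -/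
def toNats (X : DVPDAInstance) : List ℕ :=
  [X.n, X.c, X.i, X.r, X.g] ++
  ((List.finRange X.n).flatMap fun q => (List.finRange X.c).flatMap fun a =>
    [((X.M.δc q a).1 : ℕ), ((X.M.δc q a).2 : ℕ)]) ++
  ((List.finRange X.n).flatMap fun q => (List.finRange X.i).flatMap fun a =>
    [(X.M.δi q a : ℕ)]) ++
  ((List.finRange X.n).flatMap fun q => (List.finRange X.r).flatMap fun a =>
    (X.M.δr q a ⊥ : ℕ) :: (List.finRange X.g).map fun γ => (X.M.δr q a (γ : WithBot (Fin X.g)) : ℕ))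

/-- The input word of an instance. If there is a return letter, then the tables are at least as long
as each of the five sizes, so that writing the numbers in unary instead of binary changes the length
of the input only polynomially. -/
def encode (X : DVPDAInstance) : List Bool :=
  encodeNats X.toNats

end DVPDAInstance

/-- The class of languages over `{0, 1}` that are decided by a deterministic multi-stack Turing
machine in a number of steps that is bounded by a polynomial in the length of the input word; the
machine halts on every word. -/
def PTIME : Set (Language Bool) :=
  {L | ∃ f : List Bool → Bool, (∀ x, f x = true ↔ x ∈ L) ∧
    Nonempty (Turing.TM2ComputableInPolyTime (id : List Bool → List Bool) Computability.encodeBool f)}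

/-- The decision problem: given a DVPDA with at least one return letter, is there a word that
synchronizes it in the same stack model? -/
def SyncDVPDASameReturn : Language Bool :=
  {x | ∃ X : DVPDAInstance, 0 < X.r ∧ (∃ w, X.M.SyncSame w) ∧ x = X.encode}

/-! If all runs on a word end in the same state with the same stack, then appending as many return
letters as the stack is high empties it without separating the runs. Hence both synchronization
models agree once a return letter exists (`exists_syncSame_iff_exists_syncEmpty`), and it suffices
to decide the empty stack model.

The kind of a letter alone determines whether it pushes or pops, so after any word all runs have the
same stack height (`exists_run_stack`). If one run returns to `⊥`, all do, and states can therefore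
be merged one at a time: a synchronizing word exists iff every pair of states can be led from the
stack `⊥` to a pair `(q, q)` with the stack `⊥` by a common word (`exists_syncEmpty_iff`). For pairs
this is reachability in a product pushdown system. `Reach` generates it by finitely many rules over
at most `2 * n ^ 4` triples: composition, internal letters, returns on `⊥`, and a matched call and
return around a computation that leaves the stack below it untouched. Saturating this table takes
polynomially many rounds of polynomial work (`filter_saturate`, `Describes.mem_table`).

For the bound on Turing machines, a small language of structured stack programs is compiled to
machines (`Exec.after_eq`). Data are binary trees written as self-delimiting words, and the
functions that such programs compute in polynomial time (`PolyTime`) are closed under composition,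
pairing, case distinction and folds with polynomially bounded accumulators. `fun_prop` then
assembles the decision procedure. Finally `Describes` links a list of table entries to the
automaton, and `decision_iff` shows that exactly the encodings of synchronizable automata are
accepted. -/

/-- The four stacks of the machines considered below. -/
inductive Stk
  | main | save | cnt | rev
  deriving DecidableEq

instance : Fintype Stk :=
  ⟨{.main, .save, .cnt, .rev}, fun k => by cases k <;> decide⟩

/-- The contents of the four stacks. -/
abbrev Store := Stk → List Bool

/-- The store with the given contents of the stacks. -/
def st (a b c d : List Bool) : Store
  | .main => a
  | .save => b
  | .cnt => c
  | .rev => d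

@[simp] theorem st_main (a b c d : List Bool) : st a b c d .main = a := rfl
@[simp] theorem st_save (a b c d : List Bool) : st a b c d .save = b := rfl
@[simp] theorem st_cnt (a b c d : List Bool) : st a b c d .cnt = c := rfl
@[simp] theorem st_rev (a b c d : List Bool) : st a b c d .rev = d := rfl

@[simp] theorem update_st_main (a b c d x : List Bool) :
    Function.update (st a b c d) .main x = st x b c d := by
  funext k; cases k <;> simp [st, Function.update]
@[simp] theorem update_st_save (a b c d x : List Bool) :
    Function.update (st a b c d) .save x = st a x c d := by
  funext k; cases k <;> simp [st, Function.update]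
@[simp] theorem update_st_cnt (a b c d x : List Bool) :
    Function.update (st a b c d) .cnt x = st a b x d := by
  funext k; cases k <;> simp [st, Function.update]
@[simp] theorem update_st_rev (a b c d x : List Bool) :
    Function.update (st a b c d) .rev x = st a b c x := by
  funext k; cases k <;> simp [st, Function.update]

/-! ### Structured stack programs and their compilation to Turing machines. -/

/-- Structured programs over the four stacks. `case k n f t` pops the stack `k` and continues with
`n`, `f` or `t` if the stack was empty, if `false` was popped, or if `true` was popped. `loop k c`
runs `c` as long as it pops `true` from the stack `k`. -/
inductive Cmd
  | skip
  | push (k : Stk) (b : Bool)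
  | seq (c d : Cmd)
  | case (k : Stk) (n f t : Cmd)
  | loop (k : Stk) (c : Cmd)

namespace Cmd

/-- Big-step semantics, with the number of steps. -/
inductive Exec : Cmd → Store → Store → ℕ → Prop
  | skip (S) : Exec skip S S 1
  | push (k b S) : Exec (push k b) S (Function.update S k (b :: S k)) 1
  | seq {c d S S' S'' t t'} : Exec c S S' t → Exec d S' S'' t' → Exec (seq c d) S S'' (t' + t)
  | case_nil {k n f t S S' m} : S k = [] → Exec n S S' m → Exec (case k n f t) S S' (m + 1)
  | case_false {k n f t S S' m} {l} : S k = false :: l → Exec f (Function.update S k l) S' m →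
      Exec (case k n f t) S S' (m + 1)
  | case_true {k n f t S S' m} {l} : S k = true :: l → Exec t (Function.update S k l) S' m →
      Exec (case k n f t) S S' (m + 1)
  -- Leaving the loop also consumes a top symbol `false`; in `foldLoop` this removes the end mark of
  -- the list.
  | loop_exit {k c S} : (S k).head? ≠ some true →
      Exec (loop k c) S (Function.update S k (S k).tail) 1
  | loop_step {k c S S' S'' t t'} {l} : S k = true :: l → Exec c (Function.update S k l) S' t →
      Exec (loop k c) S' S'' t' → Exec (loop k c) S S'' (t' + (t + 1))

/-- The total length of the stacks. -/
def Store.total (S : Store) : ℕ :=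
  (S .main).length + (S .save).length + (S .cnt).length + (S .rev).length

theorem total_update_add (S : Store) (k : Stk) (l : List Bool) :
    Store.total (Function.update S k l) + (S k).length = Store.total S + l.length := by
  cases k <;> simp [Store.total, Function.update] <;> omega

/-- A step pushes at most one symbol. Running time thus bounds the size of results, which keeps
compositions polynomial. -/
theorem Exec.total_le {c : Cmd} {S S' : Store} {t : ℕ} (h : Exec c S S' t) :
    Store.total S' ≤ Store.total S + t := by
  induction h with
  | skip S => omega
  | push k b S => have := total_update_add S k (b :: S k); simp at this; omega
  | seq _ _ h₁ h₂ => omega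
  | case_nil _ _ h => omega
  | @case_false k _ _ _ S _ _ l hS _ h | @case_true k _ _ _ S _ _ l hS _ h =>
    have := total_update_add S k l; simp [hS] at this; omega
  | @loop_exit k c S _ =>
    have := total_update_add S k (S k).tail; simp at this; omega
  | @loop_step k _ S _ _ _ _ l hS _ _ h₁ h₂ =>
    have := total_update_add S k l; simp [hS] at this; omega

/-- The labels of the machine for a program. -/
def Lbl : Cmd → Type
  | skip => Unit
  | push _ _ => Unit
  | seq c d => c.Lbl ⊕ d.Lbl
  | case _ n f t => Option (n.Lbl ⊕ f.Lbl ⊕ t.Lbl)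
  | loop _ c => Option c.Lbl

/-- There are finitely many labels. -/
@[reducible]
def fintypeLbl : (c : Cmd) → Fintype c.Lbl
  | skip => inferInstanceAs (Fintype Unit)
  | push _ _ => inferInstanceAs (Fintype Unit)
  | seq c d =>
    letI := c.fintypeLbl
    letI := d.fintypeLbl
    inferInstanceAs (Fintype (c.Lbl ⊕ d.Lbl))
  | case _ n f t =>
    letI := n.fintypeLbl
    letI := f.fintypeLbl
    letI := t.fintypeLbl
    inferInstanceAs (Fintype (Option (n.Lbl ⊕ f.Lbl ⊕ t.Lbl)))
  | loop _ c =>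
    letI := c.fintypeLbl
    inferInstanceAs (Fintype (Option c.Lbl))

/-- The label at which a program starts. -/
def entry : (c : Cmd) → c.Lbl
  | skip => ()
  | push _ _ => ()
  | seq c _ => .inl c.entry
  | case _ _ _ _ => none
  | loop _ _ => none

/-- Statements over the four stacks; the internal state remembers the symbol that was popped. -/
abbrev Stm (L : Type) := Turing.TM2.Stmt (fun _ : Stk => Bool) L (Option Bool)

/-- Branch on the popped symbol. -/
def select {L : Type} (n f t : L) : Option Bool → L
  | none => n
  | some false => f
  | some true => t

/-- The statements of a program, whose labels are embedded into the labels of a machine by `e` and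
which leaves to the label `x`. -/
def code {L : Type} : (c : Cmd) → (c.Lbl → L) → L → c.Lbl → Stm L
  | skip, _, x, _ => .goto fun _ => x
  | push k b, _, x, _ => .push k (fun _ => b) (.goto fun _ => x)
  | seq c d, e, _, .inl l => c.code (fun l => e (.inl l)) (e (.inr d.entry)) l
  | seq _ d, e, x, .inr l => d.code (fun l => e (.inr l)) x l
  | case k n f t, e, _, none => .pop k (fun _ o => o) (.goto (select (e (some (.inl n.entry)))
      (e (some (.inr (.inl f.entry)))) (e (some (.inr (.inr t.entry))))))
  | case _ n _ _, e, x, some (.inl l) => n.code (fun l => e (some (.inl l))) x l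
  | case _ _ f _, e, x, some (.inr (.inl l)) => f.code (fun l => e (some (.inr (.inl l)))) x l
  | case _ _ _ t, e, x, some (.inr (.inr l)) => t.code (fun l => e (some (.inr (.inr l)))) x l
  | loop k c, e, x, none => .pop k (fun _ o => o) (.goto (select x x (e (some c.entry))))
  | loop _ c, e, _, some l => c.code (fun l => e (some l)) (e none) l

/-- The result of a number of steps of a machine. -/
def after {L : Type} (m : L → Stm L) (t : ℕ)
    (c : Turing.TM2.Cfg (fun _ : Stk => Bool) L (Option Bool)) :
    Option (Turing.TM2.Cfg (fun _ : Stk => Bool) L (Option Bool)) :=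
  (flip bind (Turing.TM2.step m))^[t] (some c)

theorem after_add {L : Type} (m : L → Stm L) {t t' : ℕ}
    {c c' : Turing.TM2.Cfg (fun _ : Stk => Bool) L (Option Bool)} (h : after m t c = some c') :
    after m (t' + t) c = after m t' c' := by
  rw [after, Function.iterate_add_apply]
  rw [after] at h
  rw [h, after]

theorem after_one {L : Type} (m : L → Stm L) (l : L) (v : Option Bool) (S : Store) :
    after m 1 ⟨some l, v, S⟩ = some (Turing.TM2.stepAux (m l) v S) := rfl

/-- The embedding `e` and the exit `x` vary in the induction: the first part of a sequence exits to
the entry of the second, and a loop body exits to the loop head. The internal state may be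
arbitrary, since a pop overwrites it before `select` reads it. -/
theorem Exec.after_eq {c : Cmd} {S S' : Store} {t : ℕ} (h : Exec c S S' t) {L : Type}
    (m : L → Stm L) (e : c.Lbl → L) (x : L) (hm : ∀ l, m (e l) = c.code e x l) (v : Option Bool) :
    ∃ v', after m t ⟨some (e c.entry), v, S⟩ = some ⟨some x, v', S'⟩ := by
  induction h generalizing x v with
  | skip S => exact ⟨v, by rw [after_one, hm]; rfl⟩
  | push k b S => exact ⟨v, by rw [after_one, hm]; rfl⟩
  | @seq c d _ _ _ _ _ _ _ h₁ h₂ =>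
    obtain ⟨v₁, h₁⟩ := h₁ (fun l => e (.inl l)) (e (.inr d.entry)) (fun l => hm (.inl l)) v
    obtain ⟨v₂, h₂⟩ := h₂ (fun l => e (.inr l)) x (fun l => hm (.inr l)) v₁
    exact ⟨v₂, (after_add m h₁).trans h₂⟩
  | @case_nil k n f t S _ _ hS _ h =>
    obtain ⟨v₁, h⟩ := h (fun l => e (some (.inl l))) x (fun l => hm (some (.inl l))) none
    refine ⟨v₁, (after_add m ?_).trans h⟩
    rw [after_one, hm]
    -- The machine pops even from an empty stack, which leaves that stack empty.
    have : Function.update S k [] = S := hS ▸ Function.update_eq_self k S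
    simp [entry, code, hS, select, this]
  | @case_false k n f t S _ _ l hS _ h =>
    obtain ⟨v₁, h⟩ := h (fun l => e (some (.inr (.inl l)))) x
      (fun l => hm (some (.inr (.inl l)))) (some false)
    refine ⟨v₁, (after_add m ?_).trans h⟩
    rw [after_one, hm]
    simp [entry, code, hS, select]
  | @case_true k n f t S _ _ l hS _ h =>
    obtain ⟨v₁, h⟩ := h (fun l => e (some (.inr (.inr l)))) x
      (fun l => hm (some (.inr (.inr l)))) (some true)
    refine ⟨v₁, (after_add m ?_).trans h⟩
    rw [after_one, hm]
    simp [entry, code, hS, select]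
  | @loop_exit k c S hS =>
    refine ⟨(S k).head?, ?_⟩
    rw [after_one, hm]
    rcases hk : (S k).head? with _ | _ | _
    · simp [entry, code, hk, select]
    · simp [entry, code, hk, select]
    · exact absurd hk hS
  | @loop_step k c S _ _ _ _ l hS _ _ h₁ h₂ =>
    obtain ⟨v₁, h₁⟩ := h₁ (fun l => e (some l)) (e none) (fun l => hm (some l)) (some true)
    obtain ⟨v₂, h₂⟩ := h₂ e x hm v₁
    refine ⟨v₂, (after_add m ((after_add m ?_).trans h₁)).trans h₂⟩
    rw [after_one, hm]
    simp [entry, code, hS, select]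

/-- The statements of the machine for a program, which halts after the program. -/
def prog (c : Cmd) : Option c.Lbl → Stm (Option c.Lbl)
  -- The internal state is reset because `haltList` requires the initial one; this is the one extra
  -- step in the bound `p + 1`.
  | none => .load (fun _ => none) .halt
  | some l => c.code some none l

/-- The machine for a program, with the input on the stack `save` and the output on the stack
`main`. -/
def machine (c : Cmd) : Turing.FinTM2 where
  K := Stk
  k₀ := .save
  k₁ := .main
  Γ _ := Bool
  Λ := Option c.Lbl
  main := some c.entry
  ΛFin := letI := c.fintypeLbl; inferInstance
  σ := Option Bool
  initialState := none
  Γk₀Fin := inferInstanceAs (Fintype Bool)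
  m := c.prog

/-- A function that is computed by a program in polynomial time is computable in polynomial time. -/
theorem nonempty_computableInPolyTime {f : List Bool → Bool} (c : Cmd) (p : Polynomial ℕ)
    (h : ∀ x, ∃ t ≤ p.eval x.length, Exec c (st [] x [] []) (st [f x] [] [] []) t) :
    Nonempty (Turing.TM2ComputableInPolyTime (id : List Bool → List Bool)
      Computability.encodeBool f) := by
  choose t ht hexec using h
  refine ⟨⟨⟨c.machine, Equiv.refl _, Equiv.refl _⟩, p + 1, fun x => ⟨⟨1 + t x, ?_⟩, ?_⟩⟩⟩
  · obtain ⟨v, hv⟩ := (hexec x).after_eq c.prog some none (fun _ => rfl) none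
    have h₁ : Turing.initList c.machine x =
        ⟨some (some c.entry), none, st [] x [] []⟩ := by
      refine congrArg (Turing.TM2.Cfg.mk (some (some c.entry)) none) ?_
      funext k
      cases k <;> rfl
    have h₂ : Turing.haltList c.machine [f x] = ⟨none, none, st [f x] [] [] []⟩ := by
      refine congrArg (Turing.TM2.Cfg.mk none none) ?_
      funext k
      cases k <;> rfl
    refine Eq.trans ?_ (((after_add c.prog hv).trans (after_one _ _ _ _)).trans ?_)
    · exact congrArg _ (congrArg some ((congrArg _ (List.map_id x)).trans h₁))
    · exact congrArg some h₂.symm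
  · have := ht x
    simp only [Polynomial.eval_add, Polynomial.eval_one, id]
    omega

end Cmd

/-! ### Execution within a time bound. -/

namespace Cmd

/-- The program `c` leads from the store `S` to the store `S'` in at most `n` steps. -/
def Runs (c : Cmd) (S S' : Store) (n : ℕ) : Prop :=
  ∃ t ≤ n, Exec c S S' t

namespace Runs

variable {c d f t : Cmd} {S S' S'' : Store} {m n : ℕ} {k : Stk} {l : List Bool}

theorem mono (h : Runs c S S' m) (hmn : m ≤ n) : Runs c S S' n :=
  let ⟨t, ht, h⟩ := h
  ⟨t, ht.trans hmn, h⟩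

theorem of_eq_of_le (h : Runs c S S' m) (hS : S' = S'') (hmn : m ≤ n) : Runs c S S'' n :=
  hS ▸ h.mono hmn

theorem skip : Runs skip S S 1 :=
  ⟨1, le_rfl, .skip S⟩

theorem push (k : Stk) (b : Bool) (S : Store) :
    Runs (push k b) S (Function.update S k (b :: S k)) 1 :=
  ⟨1, le_rfl, .push k b S⟩

theorem seq (h₁ : Runs c S S' m) (h₂ : Runs d S' S'' n) : Runs (seq c d) S S'' (m + n) :=
  let ⟨t₁, ht₁, h₁⟩ := h₁
  let ⟨t₂, ht₂, h₂⟩ := h₂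
  ⟨t₂ + t₁, by omega, h₁.seq h₂⟩

theorem case_nil (hS : S k = []) (h : Runs c S S' n) : Runs (case k c f t) S S' (n + 1) :=
  let ⟨t, ht, h⟩ := h
  ⟨t + 1, by omega, .case_nil hS h⟩

theorem case_false (hS : S k = false :: l) (h : Runs f (Function.update S k l) S' n) :
    Runs (case k c f t) S S' (n + 1) :=
  let ⟨t, ht, h⟩ := h
  ⟨t + 1, by omega, .case_false hS h⟩

theorem case_true (hS : S k = true :: l) (h : Runs t (Function.update S k l) S' n) :
    Runs (case k c f t) S S' (n + 1) :=
  let ⟨t, ht, h⟩ := h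
  ⟨t + 1, by omega, .case_true hS h⟩

theorem loop_exit (hS : (S k).head? ≠ some true) :
    Runs (loop k c) S (Function.update S k (S k).tail) 1 :=
  ⟨1, le_rfl, .loop_exit hS⟩

theorem loop_step (hS : S k = true :: l) (h₁ : Runs c (Function.update S k l) S' m)
    (h₂ : Runs (loop k c) S' S'' n) : Runs (loop k c) S S'' (m + n + 1) :=
  let ⟨t₁, ht₁, h₁⟩ := h₁
  let ⟨t₂, ht₂, h₂⟩ := h₂
  ⟨t₂ + (t₁ + 1), by omega, .loop_step hS h₁ h₂⟩

end Runs

end Cmd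

/-! ### Binary trees as data, and programs that move and copy them. -/

/-- S-expressions without atoms: binary trees. -/
inductive SExp
  | nil
  | cons (a b : SExp)

/-- An S-expression as a self-delimiting word. -/
def SExp.ser : SExp → List Bool
  | nil => [false]
  | cons a b => true :: (a.ser ++ b.ser)

namespace Cmd

/-- The stack `save` or the stack `main`. -/
def side (i : Bool) : Stk := if i then .save else .main

/-- The store with the content `x` of the stack `side i` and `y` of the stack `side !i`. -/
def sst (i : Bool) (x y c d : List Bool) : Store :=
  if i then st y x c d else st x y c d

/-- Move as many S-expressions as there are symbols on the stack `cnt` to the stack `rev`,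
reversing them. -/
def scan (i : Bool) : Cmd :=
  loop .cnt (case (side i) skip (push .rev false)
    (seq (push .rev true) (seq (push .cnt true) (push .cnt true))))

/-- The height of `cnt` is the number of trees still to be read: a leaf settles one, a node replaces
one by two. The statement takes the rest of the run as a hypothesis, so that the induction
hypotheses for two subtrees can be chained. -/
theorem runs_scan_ser (i : Bool) (t : SExp) : ∀ (x y c d : List Bool) (S : Store) (n : ℕ),
    Runs (scan i) (sst i x y c (t.ser.reverse ++ d)) S n →
    Runs (scan i) (sst i (t.ser ++ x) y (true :: c) d) S (n + 7 * t.ser.length) := by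
  induction t with
  | nil =>
    intro x y c d S n h
    have : Runs (case (side i) skip (push .rev false)
        (seq (push .rev true) (seq (push .cnt true) (push .cnt true))))
        (sst i (false :: x) y c d) (sst i x y c (false :: d)) 2 := by
      refine Runs.case_false (l := x) (by cases i <;> rfl) ?_
      convert Runs.push _ _ _ using 1
      cases i <;> simp [sst, side]
    refine (Runs.loop_step (l := c) (m := 2) (by cases i <;> rfl) ?_ h).mono ?_
    · cases i <;> simpa [sst, SExp.ser] using this
    · simp [SExp.ser]; omega
  | cons a b iha ihb =>
    intro x y c d S n h
    have h₁ := iha (b.ser ++ x) y (true :: c) (true :: d) S _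
      (ihb x y c (a.ser.reverse ++ true :: d) S n (by simpa [SExp.ser] using h))
    have : Runs (case (side i) skip (push .rev false)
        (seq (push .rev true) (seq (push .cnt true) (push .cnt true))))
        (sst i (true :: (a.ser ++ (b.ser ++ x))) y c d)
        (sst i (a.ser ++ (b.ser ++ x)) y (true :: true :: c) (true :: d)) 4 := by
      refine Runs.case_true (l := a.ser ++ (b.ser ++ x)) (by cases i <;> rfl) (n := 3) ?_
      convert (Runs.push _ _ _).seq ((Runs.push _ _ _).seq (Runs.push _ _ _)) using 1
      cases i <;> simp [sst, side]
    refine (Runs.loop_step (l := c) (m := 4) (by cases i <;> rfl) ?_ h₁).mono ?_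
    · cases i <;> simpa [sst, SExp.ser] using this
    · simp [SExp.ser]; omega

/-- Push or not. -/
def pushIf (a : Bool) (k : Stk) (b : Bool) : Cmd :=
  if a then push k b else skip

/-- Move the stack `rev` to the stack `main` (if `a`) and to the stack `save` (if `b`). -/
def pour (a b : Bool) : Cmd :=
  loop .cnt (case .rev skip
    (seq (pushIf a .main false) (seq (pushIf b .save false) (push .cnt true)))
    (seq (pushIf a .main true) (seq (pushIf b .save true) (push .cnt true))))

theorem runs_pushIf (a : Bool) (k : Stk) (b : Bool) (S : Store) :
    Runs (pushIf a k b) S (if a then Function.update S k (b :: S k) else S) 1 := by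
  cases a
  · exact Runs.skip
  · exact Runs.push _ _ _

/-- Here `cnt` is only a flag: its single `true` is pushed again after every symbol and stays away
once `rev` is empty. -/
theorem runs_pour (a b : Bool) (z : List Bool) : ∀ x y : List Bool,
    Runs (pour a b) (st x y [true] z)
      (st ((if a then z.reverse else []) ++ x) ((if b then z.reverse else []) ++ y) [] [])
      (5 * z.length + 4) := by
  induction z with
  | nil =>
    intro x y
    refine Runs.of_eq_of_le (Runs.loop_step (l := []) rfl (Runs.case_nil rfl Runs.skip)
      (Runs.loop_exit (by simp))) ?_ (by simp)
    cases a <;> cases b <;> simp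
  | cons v z ih =>
    intro x y
    have h := ih (if a then v :: x else x) (if b then v :: y else y)
    have h' : Runs (case .rev skip
        (seq (pushIf a .main false) (seq (pushIf b .save false) (push .cnt true)))
        (seq (pushIf a .main true) (seq (pushIf b .save true) (push .cnt true))))
        (st x y [] (v :: z)) (st (if a then v :: x else x) (if b then v :: y else y) [true] z)
        4 := by
      cases v
      · refine Runs.case_false (l := z) rfl (n := 3) ?_
        convert (runs_pushIf _ _ _ _).seq ((runs_pushIf _ _ _ _).seq (Runs.push _ _ _)) using 1
        cases a <;> cases b <;> simp
      · refine Runs.case_true (l := z) rfl (n := 3) ?_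
        convert (runs_pushIf _ _ _ _).seq ((runs_pushIf _ _ _ _).seq (Runs.push _ _ _)) using 1
        cases a <;> cases b <;> simp
    refine Runs.of_eq_of_le (Runs.loop_step (l := []) rfl (by simpa using h') h) ?_ (by simp; omega)
    cases a <;> cases b <;> simp

/-- Remove an S-expression from the stack `side i` and put it on the stack `main` (if `a`) and on
the stack `save` (if `b`). -/
def transfer (i a b : Bool) : Cmd :=
  seq (push .cnt true) (seq (scan i) (seq (push .cnt true) (pour a b)))

theorem runs_transfer (i a b : Bool) (t : SExp) (x y : List Bool) :
    Runs (transfer i a b) (sst i (t.ser ++ x) y [] [])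
      (st ((if a then t.ser else []) ++ (if i then y else x))
        ((if b then t.ser else []) ++ (if i then x else y)) [] [])
      (12 * t.ser.length + 7) := by
  have h₁ : Runs (push .cnt true) (sst i (t.ser ++ x) y [] [])
      (sst i (t.ser ++ x) y [true] []) 1 := by
    convert Runs.push _ _ _ using 1
    cases i <;> simp [sst]
  have h₂ := runs_scan_ser i t x y [] [] (sst i x y [] t.ser.reverse) 1 (by
    refine Runs.of_eq_of_le (Runs.loop_exit ?_) ?_ le_rfl
    · cases i <;> simp [sst]
    · cases i <;> simp [sst])
  have h₃ : Runs (push .cnt true) (sst i x y [] t.ser.reverse)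
      (sst i x y [true] t.ser.reverse) 1 := by
    convert Runs.push _ _ _ using 1
    cases i <;> simp [sst]
  have h₄ := runs_pour a b t.ser.reverse (if i then y else x) (if i then x else y)
  refine (h₁.seq (h₂.seq (h₃.seq (n := 5 * t.ser.length + 4) ?_))).mono ?_
  · cases i <;> simpa [sst] using h₄
  · omega

theorem runs_moveOut (t : SExp) (x y : List Bool) :
    Runs (transfer false false true) (st (t.ser ++ x) y [] []) (st x (t.ser ++ y) [] [])
      (12 * t.ser.length + 7) := by
  simpa [sst] using runs_transfer false false true t x y

theorem runs_moveBack (t : SExp) (x y : List Bool) :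
    Runs (transfer true true false) (st x (t.ser ++ y) [] []) (st (t.ser ++ x) y [] [])
      (12 * t.ser.length + 7) := by
  simpa [sst] using runs_transfer true true false t y x

theorem runs_drop (t : SExp) (x y : List Bool) :
    Runs (transfer false false false) (st (t.ser ++ x) y [] []) (st x y [] [])
      (12 * t.ser.length + 7) := by
  simpa [sst] using runs_transfer false false false t x y

/-- Duplicate the S-expression on the stack `main`. -/
def dup : Cmd :=
  seq (transfer false true true) (transfer true true false)

theorem runs_dup (t : SExp) (x y : List Bool) :
    Runs dup (st (t.ser ++ x) y [] []) (st (t.ser ++ (t.ser ++ x)) y [] [])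
      (24 * t.ser.length + 14) := by
  have h : Runs (transfer false true true) (st (t.ser ++ x) y [] [])
      (st (t.ser ++ x) (t.ser ++ y) [] []) (12 * t.ser.length + 7) := by
    simpa [sst] using runs_transfer false true true t x y
  exact (h.seq (runs_moveBack t _ y)).mono (by omega)

theorem runs_push_main (b : Bool) (x y : List Bool) :
    Runs (push .main b) (st x y [] []) (st (b :: x) y [] []) 1 := by
  simpa using Runs.push .main b (st x y [] [])

/-- Put a word on the stack `main`. -/
def pushAll : List Bool → Cmd
  | [] => skip
  | b :: l => seq (pushAll l) (push .main b)

theorem runs_pushAll (l x y : List Bool) :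
    Runs (pushAll l) (st x y [] []) (st (l ++ x) y [] []) (l.length + 1) := by
  induction l with
  | nil => exact Runs.skip
  | cons b l ih => exact ih.seq (runs_push_main b _ y)

end Cmd

theorem Polynomial.eval_le_eval_nat (p : Polynomial ℕ) {m n : ℕ} (h : m ≤ n) :
    p.eval m ≤ p.eval n := by
  rw [Polynomial.eval_eq_sum, Polynomial.eval_eq_sum]
  exact Finset.sum_le_sum fun i _ =>
    Nat.mul_le_mul_left _ (Nat.pow_le_pow_left h i)

/-! ### Polynomial-time functions on encoded data. -/

/-- Data represented by S-expressions. -/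
class Enc (α : Type) where
  /-- the representation -/
  enc : α → SExp

open Enc

/-- The length of the word that represents a datum. -/
def esize {α : Type} [Enc α] (a : α) : ℕ :=
  (enc a).ser.length

theorem SExp.length_ser_pos (t : SExp) : 0 < t.ser.length := by
  cases t <;> simp [SExp.ser]

theorem esize_pos {α : Type} [Enc α] (a : α) : 0 < esize a :=
  SExp.length_ser_pos _

instance {α β : Type} [Enc α] [Enc β] : Enc (α × β) :=
  ⟨fun x => .cons (enc x.1) (enc x.2)⟩

/-- The representation of a list. -/
def encList {α : Type} [Enc α] : List α → SExp
  | [] => .nil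
  | a :: l => .cons (enc a) (encList l)

instance {α : Type} [Enc α] : Enc (List α) :=
  ⟨encList⟩

/-- Only `true` is a node, so `branch` can test a truth value by its first symbol. -/
instance : Enc Bool :=
  ⟨fun b => if b then .cons .nil .nil else .nil⟩

instance : Enc Unit :=
  ⟨fun _ => .nil⟩

/-- Numbers are unary, as in `encodeNats`; a number and a list of units of that length have the same
representation. -/
instance : Enc ℕ :=
  ⟨fun n => encList (List.replicate n ())⟩

/-- The function `f` is computed by a program in polynomial time, where the argument is replaced by
the value on the top of the stack `main`. -/
def PolyTime {α β : Type} [Enc α] [Enc β] (f : α → β) : Prop :=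
  ∃ (c : Cmd) (p : Polynomial ℕ), ∀ (a : α) (x y : List Bool),
    c.Runs (st ((enc a).ser ++ x) y [] []) (st ((enc (f a)).ser ++ x) y [] []) (p.eval (esize a))

namespace PolyTime

variable {α β γ δ : Type} [Enc α] [Enc β] [Enc γ] [Enc δ]

theorem esize_le {f : α → β} (hf : PolyTime f) :
    ∃ p : Polynomial ℕ, ∀ a, esize (f a) ≤ p.eval (esize a) := by
  obtain ⟨c, p, h⟩ := hf
  refine ⟨.X + p, fun a => ?_⟩
  obtain ⟨t, ht, h⟩ := h a [] []
  have := h.total_le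
  simp [Cmd.Store.total] at this
  simp only [Polynomial.eval_add, Polynomial.eval_X, esize] at *
  omega

theorem of_enc_eq {f : α → β} (h : ∀ a, enc (f a) = enc a) : PolyTime f :=
  ⟨.skip, 1, fun a x y => by simpa [h a] using Cmd.Runs.skip⟩

protected theorem id : PolyTime fun a : α => a :=
  of_enc_eq fun _ => rfl

theorem comp {g : β → γ} {f : α → β} (hg : PolyTime g) (hf : PolyTime f) :
    PolyTime fun a => g (f a) := by
  obtain ⟨q, hq⟩ := hf.esize_le
  obtain ⟨c, p, h⟩ := hf
  obtain ⟨c', p', h'⟩ := hg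
  refine ⟨.seq c c', p + p'.comp q, fun a x y => ((h a x y).seq (h' (f a) x y)).mono ?_⟩
  rw [Polynomial.eval_add, Polynomial.eval_comp]
  exact Nat.add_le_add_left (p'.eval_le_eval_nat (hq a)) _

theorem const (b : β) : PolyTime fun _ : α => b :=
  ⟨.seq (.transfer false false false) (.pushAll (enc b).ser),
    12 * .X + .C ((enc b).ser.length + 8), fun a x y =>
    ((Cmd.runs_drop _ x y).seq (Cmd.runs_pushAll _ x y)).mono (by
      simp only [Polynomial.eval_add, Polynomial.eval_mul, Polynomial.eval_X, Polynomial.eval_C,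
        Polynomial.eval_ofNat, esize]
      omega)⟩

/-- The argument is duplicated, and the first value waits on `save` while the second is computed.
The final `true` joins both into a node. -/
theorem pair {f : α → β} {g : α → γ} (hf : PolyTime f) (hg : PolyTime g) :
    PolyTime fun a => (f a, g a) := by
  obtain ⟨q, hq⟩ := hf.esize_le
  obtain ⟨c, p, h⟩ := hf
  obtain ⟨c', p', h'⟩ := hg
  refine ⟨.seq .dup (.seq c (.seq (.transfer false false true) (.seq c'
    (.seq (.transfer true true false) (.push .main true))))),
    24 * .X + 14 + p + p' + 24 * q + 15, fun a x y => ?_⟩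
  have := (Cmd.runs_dup (enc a) x y).seq ((h a ((enc a).ser ++ x) y).seq
    ((Cmd.runs_moveOut (enc (f a)) ((enc a).ser ++ x) y).seq
    ((h' a x ((enc (f a)).ser ++ y)).seq
    ((Cmd.runs_moveBack (enc (f a)) ((enc (g a)).ser ++ x) y).seq (Cmd.runs_push_main true _ y)))))
  convert this.mono ?_ using 2
  · simp [enc, SExp.ser]
  · have := hq a
    simp only [Polynomial.eval_add, Polynomial.eval_mul, Polynomial.eval_X,
      Polynomial.eval_ofNat, esize] at *
    omega

theorem fst : PolyTime fun a : α × β => a.1 := by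
  refine ⟨.case .main .skip .skip (.seq (.transfer false false true)
    (.seq (.transfer false false false) (.transfer true true false))), 36 * .X + 22,
    fun a x y => ?_⟩
  have h := (Cmd.runs_moveOut (enc a.1) ((enc a.2).ser ++ x) y).seq
    ((Cmd.runs_drop (enc a.2) x ((enc a.1).ser ++ y)).seq (Cmd.runs_moveBack (enc a.1) x y))
  refine (Cmd.Runs.case_true (l := (enc a.1).ser ++ ((enc a.2).ser ++ x)) ?_
    (by simpa using h)).mono ?_
  · simp [enc, SExp.ser]
  · simp [esize, enc, SExp.ser]
    omega

theorem snd : PolyTime fun a : α × β => a.2 := by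
  refine ⟨.case .main .skip .skip (.transfer false false false), 12 * .X + 8, fun a x y => ?_⟩
  refine (Cmd.Runs.case_true (l := (enc a.1).ser ++ ((enc a.2).ser ++ x)) ?_
    (by simpa using Cmd.runs_drop (enc a.1) ((enc a.2).ser ++ x) y)).mono ?_
  · simp [enc, SExp.ser]
  · simp [esize, enc, SExp.ser]
    omega

/-- The common source of all case distinctions: `F` is evaluated on a copy of the argument and the
first symbol of its value is tested. For a node, one pushed `true` restores the popped symbol and
the other forms the pair `(e, a)`. -/
theorem branch {F : α → β} (hF : PolyTime F) {g : α → γ} (hg : PolyTime g) {k : δ × α → γ}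
    (hk : PolyTime k) {f : α → γ} (h₀ : ∀ a, enc (F a) = .nil → f a = g a)
    (h₁ : ∀ a u v, enc (F a) = .cons u v → ∃ e : δ, enc e = .cons u v ∧ f a = k (e, a)) :
    PolyTime f := by
  obtain ⟨q, hq⟩ := hF.esize_le
  obtain ⟨c, p, h⟩ := hF
  obtain ⟨c', p', h'⟩ := hg
  obtain ⟨d, r, hd⟩ := hk
  refine ⟨.seq .dup (.seq c (.case .main .skip c' (.seq (.push .main true)
    (.seq (.push .main true) d)))), 24 * .X + 14 + p + p' + r.comp (q + .X + 1) + 3,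
    fun a x y => ?_⟩
  have h₂ := h a ((enc a).ser ++ x) y
  have h₃ : Cmd.Runs (.case .main .skip c' (.seq (.push .main true) (.seq (.push .main true) d)))
      (st ((enc (F a)).ser ++ ((enc a).ser ++ x)) y [] []) (st ((enc (f a)).ser ++ x) y [] [])
      (p'.eval (esize a) + r.eval (q.eval (esize a) + esize a + 1) + 3) := by
    rcases he : enc (F a) with _ | ⟨u, v⟩
    · refine (Cmd.Runs.case_false (l := (enc a).ser ++ x) (by simp [SExp.ser]) ?_).mono
        (m := p'.eval (esize a) + 1) (by omega)
      simpa [h₀ a he] using h' a x y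
    · obtain ⟨e, hue, hf⟩ := h₁ a u v he
      refine (Cmd.Runs.case_true (l := u.ser ++ (v.ser ++ ((enc a).ser ++ x))) (by simp [SExp.ser])
        ((Cmd.Runs.push _ _ _).seq ((Cmd.Runs.push _ _ _).seq
          (n := r.eval (esize (e, a))) ?_))).mono ?_
      · have := hd (e, a) x y
        simpa [hf, enc, SExp.ser, hue] using this
      · have h₄ : esize (e, a) ≤ q.eval (esize a) + esize a + 1 := by
          have h₅ := hq a
          rw [esize, he] at h₅
          have : esize (e, a) = (SExp.cons u v).ser.length + esize a + 1 := by
            rw [← hue]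
            simp [esize, enc, SExp.ser]
          omega
        have := r.eval_le_eval_nat h₄
        omega
  refine ((Cmd.runs_dup (enc a) x y).seq (h₂.seq h₃)).mono ?_
  simp only [Polynomial.eval_add, Polynomial.eval_mul, Polynomial.eval_X,
    Polynomial.eval_ofNat, Polynomial.eval_comp, Polynomial.eval_one, esize]
  omega

/-- The loop of a program for folding over a list. -/
def foldLoop (c : Cmd) : Cmd :=
  .loop .save (.seq (.transfer true true false) (.seq (.push .main true) c))

/-- The unread part of the list lies on `save`, where its node symbols control the loop. `A` bounds
the elements and `B` all intermediate accumulators, which are the folds over prefixes. -/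
theorem runs_foldLoop {G : β × γ → γ} {c : Cmd} {p : Polynomial ℕ}
    (h : ∀ (a : β × γ) (x y : List Bool), c.Runs (st ((enc a).ser ++ x) y [] [])
      (st ((enc (G a)).ser ++ x) y [] []) (p.eval (esize a))) (A B : ℕ) (l : List β) :
    ∀ (s : γ) (x y : List Bool), (∀ b ∈ l, esize b ≤ A) →
      (∀ l', l' <+: l → esize (l'.foldl (fun s b => G (b, s)) s) ≤ B) →
      (foldLoop c).Runs (st ((enc s).ser ++ x) ((enc l).ser ++ y) [] [])
        (st ((enc (l.foldl (fun s b => G (b, s)) s)).ser ++ x) y [] [])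
        (l.length * (12 * A + p.eval (A + B + 1) + 9) + 1) := by
  induction l with
  | nil =>
    intro s x y _ _
    simpa [foldLoop, enc, encList, SExp.ser] using
      Cmd.Runs.loop_exit (S := st ((enc s).ser ++ x) (false :: y) [] []) (k := .save)
        (c := .seq (.transfer true true false) (.seq (.push .main true) c)) (by simp)
  | cons b l ih =>
    intro s x y hA hB
    have h₁ := ih (G (b, s)) x y (fun b hb => hA b (List.mem_cons_of_mem _ hb))
      (fun l' hl' => hB (b :: l') (by simpa using hl'))
    have h' := h (b, s) x ((enc l).ser ++ y)
    have h₀ : (enc (b, s)).ser ++ x = true :: ((enc b).ser ++ ((enc s).ser ++ x)) := by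
      simp [enc, SExp.ser]
    rw [h₀] at h'
    have h₂ := (Cmd.runs_moveBack (enc b) ((enc s).ser ++ x) ((enc l).ser ++ y)).seq
      ((Cmd.runs_push_main true _ _).seq (h' ))
    refine (Cmd.Runs.loop_step (l := (enc b).ser ++ ((enc l).ser ++ y))
      (by simp [enc, encList, SExp.ser]) (by simpa using h₂) h₁).mono ?_
    have h₃ : esize (b, s) ≤ A + B + 1 := by
      have h₄ := hA b (by simp)
      have h₅ := hB [] (by simp)
      have : esize (b, s) = esize b + esize s + 1 := by simp [esize, enc, SExp.ser]
      simp at h₅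
      omega
    have h₄ := p.eval_le_eval_nat h₃
    have h₅ := hA b (by simp)
    simp only [esize, List.length_cons, Nat.add_mul] at *
    omega

theorem esize_nil : esize ([] : List α) = 1 := rfl

theorem esize_cons (a : α) (l : List α) : esize (a :: l) = esize a + esize l + 1 := by
  simp [esize, enc, encList, SExp.ser]

theorem esize_pair (a : α) (b : β) : esize (a, b) = esize a + esize b + 1 := by
  simp [esize, enc, SExp.ser]

theorem esize_le_of_mem {a : α} {l : List α} (h : a ∈ l) : esize a ≤ esize l := by
  induction l with
  | nil => simp at h
  | cons b l ih =>
    rw [esize_cons]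
    rcases List.mem_cons.1 h with rfl | h
    · omega
    · have := ih h
      omega

theorem length_le_esize (l : List α) : l.length ≤ esize l := by
  induction l with
  | nil => simp
  | cons b l ih =>
    rw [esize_cons, List.length_cons]
    omega

theorem foldl_aux {L : α → List β} {I : α → γ} {G : β × γ → γ} (hL : PolyTime L) (hI : PolyTime I)
    (hG : PolyTime G) (hb : ∃ p : Polynomial ℕ, ∀ a, ∀ l', l' <+: L a →
      esize (l'.foldl (fun s b => G (b, s)) (I a)) ≤ p.eval (esize a)) :
    PolyTime fun a => (L a).foldl (fun s b => G (b, s)) (I a) := by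
  obtain ⟨q, hq⟩ := hL.esize_le
  obtain ⟨e, r, he⟩ := hL.pair hI
  obtain ⟨c, p, h⟩ := hG
  obtain ⟨s, hs⟩ := hb
  refine ⟨.seq e (.case .main .skip .skip (.seq (.transfer false false true) (foldLoop c))),
    r + 12 * q + q * (12 * q + p.comp (q + s + 1) + 9) + 9, fun a x y => ?_⟩
  have h₁ := runs_foldLoop h (q.eval (esize a)) (s.eval (esize a)) (L a) (I a) x y
    (fun b hb => (esize_le_of_mem hb).trans (hq a)) (hs a)
  have h₂ := (Cmd.runs_moveOut (enc (L a)) ((enc (I a)).ser ++ x) y).seq h₁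
  refine ((he a x y).seq (Cmd.Runs.case_true (l := (enc (L a)).ser ++ ((enc (I a)).ser ++ x))
    (by simp [enc, SExp.ser]) (by simpa using h₂))).mono ?_
  have h₃ := Nat.mul_le_mul_right (12 * q.eval (esize a) +
    p.eval (q.eval (esize a) + s.eval (esize a) + 1) + 9)
    ((length_le_esize (L a)).trans (hq a))
  have h₄ := hq a
  simp only [Polynomial.eval_add, Polynomial.eval_mul, Polynomial.eval_comp,
    Polynomial.eval_one, Polynomial.eval_ofNat]
  change (enc (L a)).ser.length ≤ _ at h₄
  omega

/-- The parameter `a` is carried along inside the accumulator. The bound `hb` is essential, since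
iterating a polynomial-time step can produce exponentially large values. -/
theorem foldl {L : α → List β} {I : α → γ} {F : α → γ → β → γ} (hL : PolyTime L)
    (hI : PolyTime I) (hF : PolyTime fun x : β × α × γ => F x.2.1 x.2.2 x.1)
    (hb : ∃ p : Polynomial ℕ, ∀ a, ∀ l', l' <+: L a →
      esize (l'.foldl (F a) (I a)) ≤ p.eval (esize a)) :
    PolyTime fun a => (L a).foldl (F a) (I a) := by
  have key : ∀ (a : α) (l : List β) (s : γ),
      l.foldl (fun (s : α × γ) b => (s.1, F s.1 s.2 b)) (a, s) = (a, l.foldl (F a) s) := by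
    intro a l
    induction l with
    | nil => intro s; rfl
    | cons b l ih => intro s; exact ih _
  obtain ⟨p, hp⟩ := hb
  have h := foldl_aux (G := fun x : β × α × γ => (x.2.1, F x.2.1 x.2.2 x.1)) hL
    (PolyTime.id.pair hI) ((fst.comp snd).pair hF) ⟨p + .X + 1, fun a l' hl' => by
      have := hp a l' hl'
      rw [key, esize_pair]
      simp only [Polynomial.eval_add, Polynomial.eval_X, Polynomial.eval_one]
      omega⟩
  refine (snd.comp h) |> cast ?_
  simp only [key]

end PolyTime

/-! ### Conversion of the input word and of the resulting bit. -/

namespace Cmd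

/-- Reverse the input on the stack `save` to the stack `rev`. -/
def unload : Cmd :=
  loop .cnt (case .save skip (seq (push .rev false) (push .cnt true))
    (seq (push .rev true) (push .cnt true)))

theorem runs_unload (x : List Bool) : ∀ y z : List Bool,
    Runs unload (st y x [true] z) (st y [] [] (x.reverse ++ z)) (4 * x.length + 4) := by
  induction x with
  | nil =>
    intro y z
    refine Runs.of_eq_of_le (Runs.loop_step (l := []) rfl (Runs.case_nil rfl Runs.skip)
      (Runs.loop_exit (by simp))) ?_ (by simp)
    simp
  | cons b x ih =>
    intro y z
    have h := ih y (b :: z)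
    have h' : Runs (case .save skip (seq (push .rev false) (push .cnt true))
        (seq (push .rev true) (push .cnt true))) (st y (b :: x) [] z) (st y x [true] (b :: z))
        3 := by
      cases b
      · exact Runs.case_false (l := x) rfl
          (by simpa using (Runs.push .rev false (st y x [] z)).seq (Runs.push .cnt true _))
      · exact Runs.case_true (l := x) rfl
          (by simpa using (Runs.push .rev true (st y x [] z)).seq (Runs.push .cnt true _))
    refine Runs.of_eq_of_le (Runs.loop_step (l := []) rfl (by simpa using h') h) ?_ (by simp; omega)
    simp

/-- Build the S-expression of the word on the stack `rev`. -/
def build : Cmd :=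
  loop .cnt (case .rev skip (seq (pushAll [true, false]) (push .cnt true))
    (seq (pushAll [true, true, false, false]) (push .cnt true)))

/-- The words `[true, false]` and `[true, true, false, false]` are what consing `false` or `true`
writes before the representation of a list. Since `unload` has reversed the input, consing restores
its order. -/
theorem runs_build (x : List Bool) : ∀ z : List Bool,
    Runs build (st (enc z).ser [] [true] x) (st (enc (x.reverse ++ z)).ser [] [] [])
      (8 * x.length + 4) := by
  induction x with
  | nil =>
    intro z
    refine Runs.of_eq_of_le (Runs.loop_step (l := []) rfl (Runs.case_nil rfl Runs.skip)
      (Runs.loop_exit (by simp))) ?_ (by simp)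
    simp
  | cons b x ih =>
    intro z
    have h := ih (b :: z)
    have h' : Runs (case .rev skip (seq (pushAll [true, false]) (push .cnt true))
        (seq (pushAll [true, true, false, false]) (push .cnt true)))
        (st (enc z).ser [] [] (b :: x)) (st (enc (b :: z)).ser [] [true] x) 7 := by
      cases b
      · refine Runs.of_eq_of_le (Runs.case_false (l := x) rfl ((((Runs.skip.seq (Runs.push .main false _)).seq
          (Runs.push .main true _))).seq (Runs.push .cnt true _))) ?_ (by omega)
        simp [enc, encList, SExp.ser]
      · refine Runs.of_eq_of_le (Runs.case_true (l := x) rfl ((((((Runs.skip.seq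
          (Runs.push .main false _)).seq (Runs.push .main false _)).seq (Runs.push .main true _)).seq
          (Runs.push .main true _))).seq (Runs.push .cnt true _))) ?_ (by omega)
        simp [enc, encList, SExp.ser]
    refine Runs.of_eq_of_le (Runs.loop_step (l := []) rfl (by simpa using h') h) ?_ (by simp; omega)
    simp

/-- Replace the S-expression of a truth value by the truth value. -/
def finish : Cmd :=
  case .main skip (push .main false)
    (case .main skip (case .main skip (push .main true) skip) skip)

theorem runs_finish (b : Bool) :
    Runs finish (st (enc b).ser [] [] []) (st [b] [] [] []) 4 := by
  cases b
  · refine Runs.of_eq_of_le (Runs.case_false (l := []) rfl (Runs.push _ _ _)) ?_ (by omega)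
    simp
  · refine Runs.of_eq_of_le (Runs.case_true (l := [false, false]) rfl (Runs.case_false (l := [false]) rfl
      (Runs.case_false (l := []) rfl (Runs.push _ _ _)))) ?_ (by omega)
    simp

end Cmd

theorem PolyTime.esize_bits_le (x : List Bool) : esize x ≤ 4 * x.length + 1 := by
  induction x with
  | nil => simp [esize_nil]
  | cons b x ih =>
    rw [esize_cons, List.length_cons]
    have : esize b ≤ 3 := by cases b <;> simp [esize, enc, SExp.ser]
    omega

theorem PolyTime.nonempty_computableInPolyTime {f : List Bool → Bool} (hf : PolyTime f) :
    Nonempty (Turing.TM2ComputableInPolyTime (id : List Bool → List Bool)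
      Computability.encodeBool f) := by
  obtain ⟨c, p, h⟩ := hf
  refine Cmd.nonempty_computableInPolyTime (.seq (.push .cnt true) (.seq .unload
    (.seq (.push .main false) (.seq (.push .cnt true) (.seq .build (.seq c .finish))))))
    (12 * .X + 15 + p.comp (4 * .X + 1)) fun x => ?_
  have h₁ : Cmd.Runs (.push .cnt true) (st [] x [] []) (st [] x [true] []) 1 := by
    simpa using Cmd.Runs.push .cnt true (st [] x [] [])
  have h₂ : Cmd.Runs (.push .main false) (st [] [] [] x.reverse)
      (st [false] [] [] x.reverse) 1 := by
    simpa using Cmd.Runs.push .main false (st [] [] [] x.reverse)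
  have h₃ : Cmd.Runs (.push .cnt true) (st [false] [] [] x.reverse)
      (st (enc ([] : List Bool)).ser [] [true] x.reverse) 1 := by
    simpa [enc, encList, SExp.ser] using Cmd.Runs.push .cnt true (st [false] [] [] x.reverse)
  have h₀ := Cmd.runs_unload x [] []
  have h₄ := h x [] []
  have h₅ := Cmd.runs_build x.reverse []
  simp only [List.reverse_reverse, List.append_nil, List.length_reverse] at h₀ h₄ h₅
  refine (h₁.seq (h₀.seq (h₂.seq (h₃.seq (h₅.seq
    (h₄.seq (Cmd.runs_finish (f x)))))))).mono ?_
  have := p.eval_le_eval_nat (esize_bits_le x)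
  simp only [Polynomial.eval_add, Polynomial.eval_mul, Polynomial.eval_X, Polynomial.eval_comp,
    Polynomial.eval_one, Polynomial.eval_ofNat]
  omega

-- A library of polynomial-time operations for `fun_prop`.

attribute [fun_prop] PolyTime

namespace PolyTime

variable {α β γ δ : Type} [Enc α] [Enc β] [Enc γ] [Enc δ]

attribute [fun_prop] PolyTime.id PolyTime.const PolyTime.comp PolyTime.fst PolyTime.snd
  PolyTime.pair

@[fun_prop]
theorem prod_fst {f : α → β × γ} (hf : PolyTime f) : PolyTime fun a => (f a).1 :=
  fst.comp hf

@[fun_prop]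
theorem prod_snd {f : α → β × γ} (hf : PolyTime f) : PolyTime fun a => (f a).2 :=
  snd.comp hf

/-- If the growth per step is bounded independently of the accumulator, the total growth is at most
the number of steps times that bound. -/
theorem foldl_of_le {L : α → List β} {I : α → γ} {F : α → γ → β → γ} (hL : PolyTime L)
    (hI : PolyTime I) (hF : PolyTime fun x : β × α × γ => F x.2.1 x.2.2 x.1)
    (hb : ∃ p : Polynomial ℕ, ∀ a s b, esize (F a s b) ≤ esize s + p.eval (esize a + esize b)) :
    PolyTime fun a => (L a).foldl (F a) (I a) := by
  obtain ⟨p, hp⟩ := hb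
  obtain ⟨q, hq⟩ := hL.esize_le
  obtain ⟨r, hr⟩ := hI.esize_le
  refine foldl hL hI hF ⟨r + q * p.comp (.X + q), fun a l' hl' => ?_⟩
  have key : ∀ (l : List β) (s : γ), (∀ b ∈ l, esize b ≤ q.eval (esize a)) →
      esize (l.foldl (F a) s) ≤ esize s + l.length * p.eval (esize a + q.eval (esize a)) := by
    intro l
    induction l with
    | nil => intro s _; simp
    | cons b l ih =>
      intro s h
      have h₁ := ih (F a s b) fun b hb => h b (List.mem_cons_of_mem _ hb)
      have h₂ := hp a s b
      have h₃ := p.eval_le_eval_nat (Nat.add_le_add_left (h b (by simp)) (esize a))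
      rw [List.foldl_cons, List.length_cons, Nat.add_mul]
      omega
  have h₁ := key l' (I a) fun b hb => (esize_le_of_mem (hl'.subset hb)).trans (hq a)
  have h₂ := Nat.mul_le_mul_right (p.eval (esize a + q.eval (esize a)))
    ((hl'.length_le.trans (length_le_esize (L a))).trans (hq a))
  have h₃ := hr a
  simp only [Polynomial.eval_add, Polynomial.eval_mul, Polynomial.eval_comp, Polynomial.eval_X]
  omega

/-! ### Truth values -/

@[fun_prop]
theorem cond {c : α → Bool} {f g : α → β} (hc : PolyTime c) (hf : PolyTime f) (hg : PolyTime g) :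
    PolyTime fun a => bif c a then f a else g a :=
  branch (δ := Bool) (k := fun x : Bool × α => f x.2) hc hg (hf.comp snd)
    (fun a h => by cases hc : c a <;> simp [enc, hc] at h ⊢)
    (fun a u v h => by
      cases hc : c a
      · simp [enc, hc] at h
      · exact ⟨true, by rw [← h, hc], rfl⟩)

@[fun_prop]
theorem and {f g : α → Bool} (hf : PolyTime f) (hg : PolyTime g) :
    PolyTime fun a => f a && g a := by
  have := cond hf hg (const false)
  convert this using 2 with a
  cases f a <;> rfl

@[fun_prop]
theorem or {f g : α → Bool} (hf : PolyTime f) (hg : PolyTime g) :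
    PolyTime fun a => f a || g a := by
  have := cond hf (const true) hg
  convert this using 2 with a
  cases f a <;> rfl

@[fun_prop]
theorem not {f : α → Bool} (hf : PolyTime f) : PolyTime fun a => !f a := by
  have := cond hf (const false) (const true)
  convert this using 2 with a
  cases f a <;> rfl

@[fun_prop]
theorem xor {f g : α → Bool} (hf : PolyTime f) (hg : PolyTime g) :
    PolyTime fun a => f a ^^ g a := by
  have := cond hf hg.not hg
  convert this using 2 with a
  cases f a <;> simp

theorem esize_bool_le (b : Bool) : esize b ≤ 3 := by
  cases b <;> simp [esize, enc, SExp.ser]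

/-! ### Lists -/

@[fun_prop]
theorem list_cons {f : α → β} {g : α → List β} (hf : PolyTime f) (hg : PolyTime g) :
    PolyTime fun a => f a :: g a :=
  comp (g := fun x : β × List β => x.1 :: x.2) (of_enc_eq fun _ => rfl) (hf.pair hg)

theorem list_case {f : α → List β} {g : α → γ} {h : (β × List β) × α → γ} (hf : PolyTime f)
    (hg : PolyTime g) (hh : PolyTime h) :
    PolyTime fun a => match f a with
      | [] => g a
      | b :: l => h ((b, l), a) :=
  branch (δ := β × List β) hf hg hh
    (fun a ha => by rcases hl : f a with _ | ⟨b, l⟩ <;> simp [enc, encList, hl] at ha ⊢)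
    (fun a u v ha => by
      rcases hl : f a with _ | ⟨b, l⟩
      · simp [enc, encList, hl] at ha
      · exact ⟨(b, l), by rw [← ha, hl]; rfl, rfl⟩)

@[fun_prop]
theorem headD {f : α → List β} {g : α → β} (hf : PolyTime f) (hg : PolyTime g) :
    PolyTime fun a => (f a).headD (g a) := by
  have := list_case (h := fun x : (β × List β) × α => x.1.1) hf hg (by fun_prop)
  convert this using 2 with a
  cases f a <;> rfl

@[fun_prop]
theorem tail {f : α → List β} (hf : PolyTime f) : PolyTime fun a => (f a).tail := by
  have := list_case (h := fun x : (β × List β) × α => x.1.2) hf (const []) (by fun_prop)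
  convert this using 2 with a
  cases f a <;> rfl

theorem reverseAux {f g : α → List β} (hf : PolyTime f) (hg : PolyTime g) :
    PolyTime fun a => (f a).reverse ++ g a := by
  have := foldl_of_le (F := fun _ s b => b :: s) hf hg (by fun_prop)
    ⟨.X + 1, fun a s b => by rw [esize_cons]; simp; omega⟩
  convert this using 2 with a
  generalize g a = s
  induction f a generalizing s with
  | nil => rfl
  | cons b l ih => rw [List.foldl_cons, ← ih]; simp

@[fun_prop]
theorem reverse {f : α → List β} (hf : PolyTime f) : PolyTime fun a => (f a).reverse := by
  simpa using reverseAux hf (const [])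

@[fun_prop]
theorem append {f g : α → List β} (hf : PolyTime f) (hg : PolyTime g) :
    PolyTime fun a => f a ++ g a := by
  simpa using reverseAux hf.reverse hg

theorem esize_append (l l' : List α) : esize (l ++ l') + 1 = esize l + esize l' := by
  induction l with
  | nil => simp [esize_nil, add_comm]
  | cons a l ih => rw [List.cons_append, esize_cons, esize_cons]; omega

@[fun_prop]
theorem flatMap {l : α → List β} {f : α → β → List γ} (hl : PolyTime l)
    (hf : PolyTime fun x : α × β => f x.1 x.2) : PolyTime fun a => (l a).flatMap (f a) := by
  obtain ⟨p, hp⟩ := hf.esize_le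
  have := foldl_of_le (F := fun a s b => s ++ f a b) (I := fun _ => []) hl (const [])
    (append (by fun_prop) (hf.comp (by fun_prop : PolyTime fun x : β × α × List γ => (x.2.1, x.1))))
    ⟨p.comp (.X + 1), fun a s b => by
      have h₁ := esize_append s (f a b)
      have h₂ := hp (a, b)
      rw [esize_pair] at h₂
      dsimp only at h₂
      simp only [Polynomial.eval_comp, Polynomial.eval_add, Polynomial.eval_X, Polynomial.eval_one]
      omega⟩
  convert this using 2 with a
  rw [List.flatMap_eq_foldl]

@[fun_prop]
theorem map {l : α → List β} {f : α → β → γ} (hl : PolyTime l)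
    (hf : PolyTime fun x : α × β => f x.1 x.2) : PolyTime fun a => (l a).map (f a) := by
  have := flatMap (f := fun a b => [f a b]) hl (hf.list_cons (const []))
  convert this using 2 with a
  induction l a <;> simp_all

@[fun_prop]
theorem filter {l : α → List β} {f : α → β → Bool} (hl : PolyTime l)
    (hf : PolyTime fun x : α × β => f x.1 x.2) : PolyTime fun a => (l a).filter (f a) := by
  have := flatMap (f := fun a b => bif f a b then [b] else []) hl (by fun_prop)
  convert this using 2 with a
  induction l a with
  | nil => rfl
  | cons b l ih => cases h : f a b <;> simp [h, ih]

theorem esize_filter_le (l : List α) (p : α → Bool) : esize (l.filter p) ≤ esize l := by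
  induction l with
  | nil => simp
  | cons a l ih =>
    rw [List.filter_cons, esize_cons]
    split
    · rw [esize_cons]; omega
    · omega

@[fun_prop]
theorem any {l : α → List β} {f : α → β → Bool} (hl : PolyTime l)
    (hf : PolyTime fun x : α × β => f x.1 x.2) : PolyTime fun a => (l a).any (f a) := by
  have := foldl_of_le (F := fun a s b => s || f a b) (I := fun _ => false) hl (const false)
    (or (by fun_prop) (hf.comp (by fun_prop : PolyTime fun x : β × α × Bool => (x.2.1, x.1))))
    ⟨3, fun a s b => by simpa using (esize_bool_le _).trans (by omega)⟩
  convert this using 2 with a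
  have : ∀ (l : List β) (s : Bool), l.foldl (fun s b => s || f a b) s = (s || l.any (f a)) := by
    intro l
    induction l with
    | nil => simp
    | cons b l ih => intro s; simp [ih, Bool.or_assoc]
  simp [this]

@[fun_prop]
theorem all {l : α → List β} {f : α → β → Bool} (hl : PolyTime l)
    (hf : PolyTime fun x : α × β => f x.1 x.2) : PolyTime fun a => (l a).all (f a) := by
  have := (any (f := fun a b => !f a b) hl (by fun_prop)).not
  convert this using 2 with a
  simp [List.any_eq_not_all_not]

@[fun_prop]
theorem product {f : α → List β} {g : α → List γ} (hf : PolyTime f) (hg : PolyTime g) :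
    PolyTime fun a => f a ×ˢ g a := by
  have := flatMap (f := fun a b => (g a).map fun c => (b, c)) hf (by fun_prop)
  exact this

/-! ### Numbers -/

theorem enc_succ (n : ℕ) : enc (n + 1) = .cons .nil (enc n) := rfl

theorem esize_nat (n : ℕ) : esize n = 2 * n + 1 := by
  induction n with
  | zero => rfl
  | succ n ih =>
    simp only [esize] at *
    rw [enc_succ]
    simp only [SExp.ser, List.length_cons, List.length_append, ih]
    simp
    omega

@[fun_prop]
theorem replicate_unit {f : α → ℕ} (hf : PolyTime f) :
    PolyTime fun a => List.replicate (f a) () :=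
  comp (g := fun n => List.replicate n ()) (of_enc_eq fun _ => rfl) hf

@[fun_prop]
theorem length {f : α → List β} (hf : PolyTime f) : PolyTime fun a => (f a).length := by
  have : PolyTime fun a => (f a).map fun _ => () := by fun_prop
  have h : PolyTime fun l : List Unit => l.length := of_enc_eq fun l => by
    change encList (List.replicate l.length ()) = encList l
    congr 1
    exact (List.eq_replicate_iff.2 ⟨rfl, fun _ _ => rfl⟩).symm
  simpa using h.comp this

@[fun_prop]
theorem add {f g : α → ℕ} (hf : PolyTime f) (hg : PolyTime g) : PolyTime fun a => f a + g a := by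
  have : PolyTime fun a => (List.replicate (f a) () ++ List.replicate (g a) ()).length := by
    fun_prop
  simpa using this

@[fun_prop]
theorem mul {f g : α → ℕ} (hf : PolyTime f) (hg : PolyTime g) : PolyTime fun a => f a * g a := by
  have : PolyTime fun a => (List.replicate (f a) () ×ˢ List.replicate (g a) ()).length := by
    fun_prop
  simpa [List.length_product] using this

theorem iterate {n : α → ℕ} {f : α → β} {g : β → β} (hn : PolyTime n) (hf : PolyTime f)
    (hg : PolyTime g) (hb : ∀ b, esize (g b) ≤ esize b) : PolyTime fun a => g^[n a] (f a) := by
  have := foldl_of_le (F := fun _ s _ => g s) hn.replicate_unit hf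
    (hg.comp (by fun_prop : PolyTime fun x : Unit × α × β => x.2.2))
    ⟨0, fun _ s _ => by simpa using hb s⟩
  convert this using 2 with a
  rw [List.foldl_const, List.length_replicate]

@[fun_prop]
theorem drop {n : α → ℕ} {f : α → List β} (hn : PolyTime n) (hf : PolyTime f) :
    PolyTime fun a => (f a).drop (n a) := by
  have := iterate (g := List.tail) hn hf (tail .id) fun l => by
    cases l with
    | nil => simp
    | cons b l => rw [esize_cons, List.tail_cons]; omega
  convert this using 2 with a
  induction n a with
  | zero => rfl
  | succ k ih => rw [Function.iterate_succ_apply', ← ih, List.tail_drop]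

@[fun_prop]
theorem getD {n : α → ℕ} {f : α → List β} {g : α → β} (hf : PolyTime f) (hn : PolyTime n)
    (hg : PolyTime g) : PolyTime fun a => (f a).getD (n a) (g a) := by
  have : PolyTime fun a => ((f a).drop (n a)).headD (g a) := by fun_prop
  convert this using 2 with a
  simp [List.headD_eq_head?_getD, List.head?_drop]

@[fun_prop]
theorem isEmpty {f : α → List β} (hf : PolyTime f) : PolyTime fun a => (f a).isEmpty := by
  have := list_case (h := fun _ => false) hf (const true) (const false)
  convert this using 2 with a
  cases f a <;> rfl

@[fun_prop]
theorem lt {f g : α → ℕ} (hf : PolyTime f) (hg : PolyTime g) :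
    PolyTime fun a => decide (f a < g a) := by
  have : PolyTime fun a => !((List.replicate (g a) ()).drop (f a)).isEmpty := by fun_prop
  convert this using 2 with a
  rw [Bool.eq_iff_iff]
  simp
  omega

@[fun_prop]
theorem eq {f g : α → ℕ} (hf : PolyTime f) (hg : PolyTime g) :
    PolyTime fun a => decide (f a = g a) := by
  have : PolyTime fun a => !decide (f a < g a) && !decide (g a < f a) := by fun_prop
  convert this using 2 with a
  rw [Bool.eq_iff_iff]
  simp
  omega

theorem esize_range_le (n : ℕ) : esize (List.range n) ≤ n * (2 * n + 2) + 1 := by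
  induction n with
  | zero => simp [esize_nil]
  | succ n ih =>
    have h := esize_append (List.range n) [n]
    rw [esize_cons, esize_nil, esize_nat] at h
    rw [List.range_succ]
    nlinarith

-- The number appended in a step depends on the accumulator, so `foldl_of_le` does not fit. Instead,
-- each intermediate value is itself a range, of quadratic size.
@[fun_prop]
theorem range {n : α → ℕ} (hn : PolyTime n) : PolyTime fun a => List.range (n a) := by
  have key : ∀ k, (List.replicate k ()).foldl (fun s _ => s ++ [s.length]) [] = List.range k := by
    intro k
    induction k with
    | zero => rfl
    | succ k ih => rw [List.replicate_succ', List.foldl_append, ih]; simp [List.range_succ]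
  have : PolyTime fun k : ℕ => (List.replicate k ()).foldl (fun s _ => s ++ [s.length]) [] := by
    refine foldl (F := fun _ s _ => s ++ [s.length]) (by fun_prop) (const []) (by fun_prop)
      ⟨.X * (2 * .X + 2) + 1, fun k l' hl' => ?_⟩
    obtain ⟨m, hm⟩ : ∃ m, l' = List.replicate m () :=
      ⟨_, List.eq_replicate_iff.2 ⟨rfl, fun _ _ => rfl⟩⟩
    subst hm
    have h := hl'.length_le
    rw [List.length_replicate, List.length_replicate] at h
    rw [key]
    refine (esize_range_le m).trans ?_
    simp only [Polynomial.eval_add, Polynomial.eval_mul, Polynomial.eval_X, Polynomial.eval_ofNat,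
      Polynomial.eval_one, esize_nat]
    nlinarith
  simp only [key] at this
  exact this.comp hn

end PolyTime

/-! ### Runs, stack heights and reachability of pairs of states. -/

namespace DVPDA

variable {Q C I R G : Type*} (M : DVPDA Q C I R G)

theorem run_nil (c : Q × List (WithBot G)) : M.run c [] = some c := rfl

theorem run_cons (c : Q × List (WithBot G)) (a : Letter C I R) (w : List (Letter C I R)) :
    M.run c (a :: w) = (M.step c a).bind fun c => M.run c w := rfl

theorem run_append (c : Q × List (WithBot G)) (v w : List (Letter C I R)) :
    M.run c (v ++ w) = (M.run c v).bind fun c => M.run c w := by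
  simp only [run, List.foldlM_append]
  rfl

theorem run_append_of_eq {c c' c'' : Q × List (WithBot G)} {v w : List (Letter C I R)}
    (hv : M.run c v = some c') (hw : M.run c' w = some c'') : M.run c (v ++ w) = some c'' := by
  rw [run_append, hv]
  exact hw

theorem step_call (q : Q) (γ : WithBot G) (s : List (WithBot G)) (a : C) :
    M.step (q, γ :: s) (.call a : Letter C I R) =
      some ((M.δc q a).1, ((M.δc q a).2 : WithBot G) :: γ :: s) := by
  cases γ <;> rfl

theorem step_int (q : Q) (γ : WithBot G) (s : List (WithBot G)) (a : I) :
    M.step (q, γ :: s) (.int a : Letter C I R) = some (M.δi q a, γ :: s) := by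
  cases γ <;> rfl

/-- The stack with the symbols of `l` above the bottom symbol. -/
def stack (l : List G) : List (WithBot G) :=
  l.map (fun γ => (γ : WithBot G)) ++ [⊥]

theorem stack_nil : stack ([] : List G) = [⊥] := rfl

theorem stack_cons (γ : G) (l : List G) : stack (γ :: l) = (γ : WithBot G) :: stack l := rfl

theorem exists_stack_eq_cons (l : List G) : ∃ γ s, stack l = γ :: s := by
  cases l <;> exact ⟨_, _, rfl⟩

theorem stack_eq_bot {l : List G} (h : stack l = [⊥]) : l = [] := by
  simpa [stack] using congrArg List.length h

theorem step_call_stack (q : Q) (l : List G) (a : C) :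
    M.step (q, stack l) (.call a : Letter C I R) =
      some ((M.δc q a).1, stack ((M.δc q a).2 :: l)) := by
  obtain ⟨γ, s, h⟩ := exists_stack_eq_cons l
  rw [stack_cons, h, step_call]

theorem step_int_stack (q : Q) (l : List G) (a : I) :
    M.step (q, stack l) (.int a : Letter C I R) = some (M.δi q a, stack l) := by
  obtain ⟨γ, s, h⟩ := exists_stack_eq_cons l
  rw [h, step_int]

/-- The effect of a letter on the number of symbols above the bottom symbol. -/
def height : ℕ → Letter C I R → ℕ
  | n, .call _ => n + 1
  | n, .int _ => n
  -- Truncated subtraction is intended: at height `0` the symbol `⊥` is read but not popped.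
  | n, .ret _ => n - 1

/-- This is where visibility enters: the final height does not depend on the state or on the
symbols. Runs above `⊥` also never get stuck. -/
theorem exists_run_stack (w : List (Letter C I R)) : ∀ (q : Q) (l : List G),
    ∃ q' l', M.run (q, stack l) w = some (q', stack l') ∧
      l'.length = w.foldl height l.length := by
  induction w with
  | nil => exact fun q l => ⟨q, l, rfl, rfl⟩
  | cons a w ih =>
    intro q l
    rcases a with a | a | a
    · obtain ⟨q', l', h, hl⟩ := ih (M.δc q a).1 ((M.δc q a).2 :: l)
      exact ⟨q', l', by rw [run_cons, step_call_stack]; exact h, hl⟩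
    · obtain ⟨q', l', h, hl⟩ := ih (M.δi q a) l
      exact ⟨q', l', by rw [run_cons, step_int_stack]; exact h, hl⟩
    · rcases l with _ | ⟨γ, l⟩
      · obtain ⟨q', l', h, hl⟩ := ih (M.δr q a ⊥) []
        exact ⟨q', l', h, hl⟩
      · obtain ⟨q', l', h, hl⟩ := ih (M.δr q a γ) l
        exact ⟨q', l', h, hl⟩

theorem foldl_height_ret (b : R) (n : ℕ) :
    (List.replicate n (Letter.ret b : Letter C I R)).foldl height n = 0 := by
  induction n with
  | zero => rfl
  | succ n ih => exact ih

theorem exists_run_bot {w : List (Letter C I R)} (hw : w.foldl height 0 = 0) (q : Q) :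
    ∃ q', M.run (q, [⊥]) w = some (q', [⊥]) := by
  obtain ⟨q', l', h, hl⟩ := M.exists_run_stack w q []
  rw [List.length_nil, hw, List.length_eq_zero_iff] at hl
  subst hl
  exact ⟨q', h⟩

theorem height_of_run_bot {w : List (Letter C I R)} {q q' : Q}
    (h : M.run (q, [⊥]) w = some (q', [⊥])) : w.foldl height 0 = 0 := by
  obtain ⟨q'', l', h', hl⟩ := M.exists_run_stack w q []
  rw [stack_nil, h, Option.some_inj, Prod.mk.injEq] at h'
  rw [stack_eq_bot h'.2.symm] at hl
  exact hl.symm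

/-- A word that synchronizes in the same stack model can be continued, with return letters, to a
word that synchronizes in the empty stack model. -/
theorem exists_syncSame_iff_exists_syncEmpty [Nonempty R] [Nonempty Q] :
    (∃ w, M.SyncSame w) ↔ ∃ w, M.SyncEmpty w := by
  constructor
  · rintro ⟨w, p, s, hw⟩
    obtain ⟨b⟩ := ‹Nonempty R›
    obtain ⟨q₀⟩ := ‹Nonempty Q›
    obtain ⟨p', l, h, -⟩ := M.exists_run_stack w q₀ []
    rw [stack_nil, hw q₀, Option.some_inj, Prod.mk.injEq] at h
    obtain ⟨q', l', h', hl⟩ := M.exists_run_stack (List.replicate l.length (.ret b)) p l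
    rw [foldl_height_ret, List.length_eq_zero_iff] at hl
    subst hl
    exact ⟨w ++ List.replicate l.length (.ret b), q', fun q =>
      M.run_append_of_eq (hw q) (by rw [h.2]; exact h')⟩
  · rintro ⟨w, p, hw⟩
    exact ⟨w, p, _, hw⟩

/-- Reachability between pairs of states by a common word, from a stack to the same stack. With
`true`, the symbols on the stack are not touched; with `false`, the stack is `⊥`, which may be
read. -/
inductive Reach : Bool → Q × Q → Q × Q → Prop
  | refl (h p) : Reach h p p
  | int (h p a) : Reach h p (M.δi p.1 a, M.δi p.2 a)
  | bot (p b) : Reach false p (M.δr p.1 b ⊥, M.δr p.2 b ⊥)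
  | trans {h p q r} : Reach h p q → Reach h q r → Reach h p r
  -- The inner computation needs mode `true` in either case, since it runs above the two pushed
  -- symbols, which may differ.
  | nest (h p a b) {q} : Reach true ((M.δc p.1 a).1, (M.δc p.2 a).1) q →
      Reach h p (M.δr q.1 b (M.δc p.1 a).2, M.δr q.2 b (M.δc p.2 a).2)

variable {M}

/-- The word is chosen before the stacks; `nest` uses this by applying the induction hypothesis to
the stacks enlarged by the call. -/
theorem Reach.exists_word {h : Bool} {p q : Q × Q} (hpq : M.Reach h p q) :
    ∃ w : List (Letter C I R), ∀ l₁ l₂ : List G, (h = false → l₁ = [] ∧ l₂ = []) →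
      M.run (p.1, stack l₁) w = some (q.1, stack l₁) ∧
      M.run (p.2, stack l₂) w = some (q.2, stack l₂) := by
  induction hpq with
  | refl h p => exact ⟨[], fun l₁ l₂ _ => ⟨rfl, rfl⟩⟩
  | int h p a =>
    exact ⟨[.int a], fun l₁ l₂ _ => by simp [run_cons, run_nil, step_int_stack]⟩
  | bot p b =>
    refine ⟨[.ret b], fun l₁ l₂ hl => ?_⟩
    obtain ⟨rfl, rfl⟩ := hl rfl
    exact ⟨rfl, rfl⟩
  | trans _ _ ih₁ ih₂ =>
    obtain ⟨v, hv⟩ := ih₁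
    obtain ⟨w, hw⟩ := ih₂
    exact ⟨v ++ w, fun l₁ l₂ hl => ⟨M.run_append_of_eq (hv l₁ l₂ hl).1 (hw l₁ l₂ hl).1,
      M.run_append_of_eq (hv l₁ l₂ hl).2 (hw l₁ l₂ hl).2⟩⟩
  | nest h p a b _ ih =>
    obtain ⟨w, hw⟩ := ih
    refine ⟨.call a :: (w ++ [.ret b]), fun l₁ l₂ _ => ?_⟩
    have := hw ((M.δc p.1 a).2 :: l₁) ((M.δc p.2 a).2 :: l₂) (by simp)
    rw [run_cons, run_cons, step_call_stack, step_call_stack]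
    exact ⟨M.run_append_of_eq this.1 rfl, M.run_append_of_eq this.2 rfl⟩

variable (M)

/-- Reachability between pairs of states, from a pair of stacks of the same height to the
stack `⊥`. -/
def Descend : Q × Q → List (G × G) → Q × Q → Prop
  | p, [], q => M.Reach false p q
  | p, γ :: l, q => ∃ r b, M.Reach true p r ∧
      Descend (M.δr r.1 b γ.1, M.δr r.2 b γ.2) l q

variable {M}

theorem Reach.descend {p p' q : Q × Q} {l : List (G × G)} (h : ∀ h, M.Reach h p p')
    (h' : M.Descend p' l q) : M.Descend p l q := by
  cases l with
  | nil => exact (h false).trans h'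
  | cons γ l =>
    obtain ⟨r, b, hr, hd⟩ := h'
    exact ⟨r, b, (h true).trans hr, hd⟩

/-- Suffixes of a word start with nonempty stacks, so the induction needs `Descend`, where the stack
symbols are popped one by one with `Reach true` in between. After a call, the first stage of the
descent ends with the matching return, and together they form an instance of `nest`. -/
theorem descend_of_run (w : List (Letter C I R)) : ∀ (p q : Q × Q) (l : List (G × G)),
    M.run (p.1, stack (l.map Prod.fst)) w = some (q.1, [⊥]) →
    M.run (p.2, stack (l.map Prod.snd)) w = some (q.2, [⊥]) → M.Descend p l q := by
  induction w with
  | nil =>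
    intro p q l h₁ h₂
    rw [run_nil, Option.some_inj, Prod.mk.injEq] at h₁ h₂
    obtain rfl : p = q := Prod.ext h₁.1 h₂.1
    obtain rfl : l = [] := by simpa using stack_eq_bot h₁.2
    exact .refl _ _
  | cons a w ih =>
    intro p q l h₁ h₂
    rcases a with a | a | b
    · rw [run_cons, step_call_stack] at h₁ h₂
      obtain ⟨r, b, hr, hd⟩ := ih ((M.δc p.1 a).1, (M.δc p.2 a).1) q
        (((M.δc p.1 a).2, (M.δc p.2 a).2) :: l) h₁ h₂
      exact Reach.descend (fun h => .nest h p a b hr) hd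
    · rw [run_cons, step_int_stack] at h₁ h₂
      exact Reach.descend (fun h => .int h p a) (ih (M.δi p.1 a, M.δi p.2 a) q l h₁ h₂)
    · rcases l with _ | ⟨γ, l⟩
      · exact (Reach.bot p b).trans (ih (M.δr p.1 b ⊥, M.δr p.2 b ⊥) q [] h₁ h₂)
      · exact ⟨p, b, .refl _ _, ih (M.δr p.1 b γ.1, M.δr p.2 b γ.2) q l h₁ h₂⟩

theorem exists_syncEmpty_iff [Finite Q] [Nonempty Q] :
    (∃ w, M.SyncEmpty w) ↔ ∀ p : Q × Q, ∃ q, M.Reach false p (q, q) := by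
  classical
  constructor
  · rintro ⟨w, q, hw⟩ p
    exact ⟨q, descend_of_run w p (q, q) [] (hw p.1) (hw p.2)⟩
  · intro h
    -- Height `0` is part of the invariant: it ensures that the state inserted next, on which
    -- nothing is known yet, also arrives with the stack `⊥`.
    have key : ∀ S : Finset Q, ∃ (w : List (Letter C I R)) (r : Q), w.foldl height 0 = 0 ∧
        ∀ q ∈ S, M.run (q, [⊥]) w = some (r, [⊥]) := by
      intro S
      induction S using Finset.induction_on with
      | empty => exact ⟨[], Classical.arbitrary Q, rfl, by simp⟩
      | insert q S _ ih =>
        obtain ⟨w, r, hw, hr⟩ := ih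
        obtain ⟨q', hq'⟩ := M.exists_run_bot hw q
        obtain ⟨m, hm⟩ := h (r, q')
        obtain ⟨v, hv⟩ := hm.exists_word
        obtain ⟨h₁, h₂⟩ := hv [] [] fun _ => ⟨rfl, rfl⟩
        refine ⟨w ++ v, m, ?_, fun p hp => ?_⟩
        · rw [List.foldl_append, hw]
          exact M.height_of_run_bot h₁
        · rcases Finset.mem_insert.1 hp with rfl | hp
          · exact M.run_append_of_eq hq' h₂
          · exact M.run_append_of_eq (hr p hp) h₁
    cases nonempty_fintype Q
    obtain ⟨w, r, -, hr⟩ := key Finset.univ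
    exact ⟨w, r, fun q => hr q (Finset.mem_univ q)⟩

end DVPDA

/-! ### Saturation -/

/-- Starting with the empty list, repeatedly select the elements of `U` that are derived from the
previously selected ones. -/
def saturate {α : Type} (U : List α) (φ : List α → α → Bool) : List α :=
  U.foldl (fun T _ => U.filter (φ T)) []

section Saturate

variable {α : Type} {U : List α} {φ : List α → α → Bool}

theorem saturate_eq_iterate : saturate U φ = (fun T => U.filter (φ T))^[U.length] [] :=
  List.foldl_const _ _ _

theorem saturate_induction {p : α → Prop}
    (h : ∀ T x, (∀ y ∈ T, p y) → x ∈ U → φ T x = true → p x) : ∀ x ∈ saturate U φ, p x := by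
  rw [saturate_eq_iterate]
  generalize U.length = n
  induction n with
  | zero => simp
  | succ n ih =>
    intro x hx
    rw [Function.iterate_succ_apply', List.mem_filter] at hx
    exact h _ x ih hx.1 hx.2

/-- By monotonicity the stages form an increasing chain of sublists of `U`. A stage that is not
final gains an element, so `U.length` rounds reach the fixed point. -/
theorem filter_saturate (hφ : ∀ T T' x, T ⊆ T' → φ T x = true → φ T' x = true) :
    U.filter (φ (saturate U φ)) = saturate U φ := by
  have hmono : ∀ n, ((fun T => U.filter (φ T))^[n] []).Sublist
      ((fun T => U.filter (φ T))^[n + 1] []) := by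
    intro n
    induction n with
    | zero => simp
    | succ n ih =>
      rw [Function.iterate_succ_apply', Function.iterate_succ_apply' _ (n + 1)]
      exact List.monotone_filter_right U fun x => hφ _ _ x ih.subset
  have key : ∀ n, U.filter (φ ((fun T => U.filter (φ T))^[n] [])) = (fun T => U.filter (φ T))^[n] []
      ∨ n + 1 ≤ ((fun T => U.filter (φ T))^[n + 1] []).length := by
    intro n
    induction n with
    | zero =>
      rcases h : U.filter (φ []) with _ | ⟨x, l⟩
      · exact .inl h
      · exact .inr (by simp [h])
    | succ n ih =>
      rcases ih with ih | ih
      · left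
        have : (fun T => U.filter (φ T))^[n + 1] [] = (fun T => U.filter (φ T))^[n] [] := by
          rw [Function.iterate_succ_apply']
          exact ih
        rw [this]
        exact ih
      · rcases (hmono (n + 1)).length_le.lt_or_eq with h | h
        · exact .inr (by omega)
        · left
          have := (hmono (n + 1)).eq_of_length h
          rw [Function.iterate_succ_apply' _ (n + 1)] at this
          exact this.symm
  rw [saturate_eq_iterate]
  refine (key U.length).resolve_right fun h => ?_
  rw [Function.iterate_succ_apply'] at h
  have := List.length_filter_le (φ ((fun T => U.filter (φ T))^[U.length] [])) U
  omega

theorem mem_saturate (hφ : ∀ T T' x, T ⊆ T' → φ T x = true → φ T' x = true) {x : α} (hx : x ∈ U)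
    (h : φ (saturate U φ) x = true) : x ∈ saturate U φ := by
  rw [← filter_saturate hφ]
  exact List.mem_filter.2 ⟨hx, h⟩

end Saturate

namespace PolyTime

variable {α β : Type} [Enc α] [Enc β]

@[fun_prop]
theorem saturate {U : α → List β} {φ : α → List β → β → Bool} (hU : PolyTime U)
    (hφ : PolyTime fun x : (α × List β) × β => φ x.1.1 x.1.2 x.2) :
    PolyTime fun a => saturate (U a) (φ a) := by
  obtain ⟨p, hp⟩ := hU.esize_le
  -- Every accumulator is empty or a filtered copy of `U a`, so its size never exceeds that of `U
  -- a`.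
  refine foldl (F := fun a T _ => (U a).filter (φ a T)) hU (const []) ?_ ⟨p, fun a l' hl' => ?_⟩
  · exact filter (f := fun (x : β × α × List β) b => φ x.2.1 x.2.2 b) (by fun_prop)
      (hφ.comp (by fun_prop : PolyTime fun x : (β × α × List β) × β =>
        ((x.1.2.1, x.1.2.2), x.2)))
  · rcases List.eq_nil_or_concat l' with rfl | ⟨l, b, rfl⟩
    · exact Nat.le_trans (esize_pos _) (hp a)
    · rw [List.concat_eq_append, List.foldl_append]
      exact (esize_filter_le _ _).trans (hp a)

end PolyTime

/-! ### The algorithm -/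

namespace DVPDAInstance

/-- An entry of a list of numbers. -/
abbrev entry (l : List ℕ) (k : ℕ) : ℕ := l.getD k 0

/-- The table entry for the state after a call letter. -/
def callState (l : List ℕ) (q a : ℕ) : ℕ :=
  entry l (5 + (q * entry l 1 + a) * 2)

/-- The table entry for the symbol that is pushed. -/
def callSymbol (l : List ℕ) (q a : ℕ) : ℕ :=
  entry l (5 + ((q * entry l 1 + a) * 2 + 1))

/-- The table entry for the state after an internal letter. -/
def intState (l : List ℕ) (q a : ℕ) : ℕ :=
  entry l (5 + (entry l 0 * (entry l 1 * 2) + (q * entry l 2 + a)))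

/-- The table entry for the state after a return letter, where `0` stands for the bottom symbol and
`γ + 1` for the other symbols. -/
def retState (l : List ℕ) (q a γ : ℕ) : ℕ :=
  entry l (5 + (entry l 0 * (entry l 1 * 2) + (entry l 0 * entry l 2 +
    ((q * entry l 3 + a) * (entry l 4 + 1) + γ))))

/-- The list has the right length and its entries are in the right ranges. -/
def valid (l : List ℕ) : Bool :=
  decide (0 < entry l 0) && decide (0 < entry l 3) &&
  decide (l.length = 5 + (entry l 0 * (entry l 1 * 2) + (entry l 0 * entry l 2 +
    entry l 0 * (entry l 3 * (entry l 4 + 1))))) &&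
  (List.range (entry l 0)).all fun q =>
    ((List.range (entry l 1)).all fun a =>
      decide (callState l q a < entry l 0) && decide (callSymbol l q a < entry l 4)) &&
    ((List.range (entry l 2)).all fun a => decide (intState l q a < entry l 0)) &&
    (List.range (entry l 3)).all fun a => (List.range (entry l 4 + 1)).all fun γ =>
      decide (retState l q a γ < entry l 0)

/-- Equality of pairs of numbers. -/
def pairEq (x y : ℕ × ℕ) : Bool :=
  decide (x.1 = y.1) && decide (x.2 = y.2)

/-- The pairs of states. -/
def statePairs (l : List ℕ) : List (ℕ × ℕ) :=
  List.range (entry l 0) ×ˢ List.range (entry l 0)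

/-- The elements of the table of the relation `DVPDA.Reach`. -/
def transitions (l : List ℕ) : List (Bool × (ℕ × ℕ) × (ℕ × ℕ)) :=
  [false, true] ×ˢ (statePairs l ×ˢ statePairs l)

/-- The rules that derive elements of the table. -/
def derives (l : List ℕ) (T : List (Bool × (ℕ × ℕ) × (ℕ × ℕ))) (x : Bool × (ℕ × ℕ) × (ℕ × ℕ)) :
    Bool :=
  pairEq x.2.1 x.2.2 ||
  ((List.range (entry l 2)).any fun a =>
    pairEq x.2.2 (intState l x.2.1.1 a, intState l x.2.1.2 a)) ||
  (!x.1 && (List.range (entry l 3)).any fun b =>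
    pairEq x.2.2 (retState l x.2.1.1 b 0, retState l x.2.1.2 b 0)) ||
  (T.any fun y => T.any fun z => !(x.1 ^^ y.1) && !(x.1 ^^ z.1) && pairEq y.2.1 x.2.1 &&
    pairEq y.2.2 z.2.1 && pairEq z.2.2 x.2.2) ||
  ((List.range (entry l 1)).any fun a => (List.range (entry l 3)).any fun b => T.any fun y =>
    y.1 && pairEq y.2.1 (callState l x.2.1.1 a, callState l x.2.1.2 a) &&
    pairEq x.2.2 (retState l y.2.2.1 b (callSymbol l x.2.1.1 a + 1),
      retState l y.2.2.2 b (callSymbol l x.2.1.2 a + 1)))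

/-- The table of the relation `DVPDA.Reach`. -/
def table (l : List ℕ) : List (Bool × (ℕ × ℕ) × (ℕ × ℕ)) :=
  saturate (transitions l) (derives l)

/-- Every pair of states reaches a pair of equal states. -/
def accepts (l : List ℕ) : Bool :=
  (statePairs l).all fun p => (List.range (entry l 0)).any fun q => (table l).any fun y =>
    !y.1 && pairEq y.2.1 p && pairEq y.2.2 (q, q)

/-- Read the numbers of a binary word: the number that has not been completed and the list of the
previous numbers, in reverse order. -/
def parse (x : List Bool) : ℕ × List ℕ :=
  x.foldl (fun s b => bif b then (s.1 + 1, s.2) else (0, s.1 :: s.2)) (0, [])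

/-- The decision procedure. -/
def decision (x : List Bool) : Bool :=
  decide ((parse x).1 = 0) && (valid (parse x).2.reverse && accepts (parse x).2.reverse)

end DVPDAInstance

namespace PolyTime

open DVPDAInstance

variable {α : Type} [Enc α]

@[fun_prop]
theorem callState {l : α → List ℕ} {q a : α → ℕ} (hl : PolyTime l) (hq : PolyTime q)
    (ha : PolyTime a) : PolyTime fun x => callState (l x) (q x) (a x) := by
  unfold DVPDAInstance.callState
  fun_prop

@[fun_prop]
theorem callSymbol {l : α → List ℕ} {q a : α → ℕ} (hl : PolyTime l) (hq : PolyTime q)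
    (ha : PolyTime a) : PolyTime fun x => callSymbol (l x) (q x) (a x) := by
  unfold DVPDAInstance.callSymbol
  fun_prop

@[fun_prop]
theorem intState {l : α → List ℕ} {q a : α → ℕ} (hl : PolyTime l) (hq : PolyTime q)
    (ha : PolyTime a) : PolyTime fun x => intState (l x) (q x) (a x) := by
  unfold DVPDAInstance.intState
  fun_prop

@[fun_prop]
theorem retState {l : α → List ℕ} {q a γ : α → ℕ} (hl : PolyTime l) (hq : PolyTime q)
    (ha : PolyTime a) (hγ : PolyTime γ) :
    PolyTime fun x => retState (l x) (q x) (a x) (γ x) := by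
  unfold DVPDAInstance.retState
  fun_prop

@[fun_prop]
theorem pairEq {f g : α → ℕ × ℕ} (hf : PolyTime f) (hg : PolyTime g) :
    PolyTime fun a => pairEq (f a) (g a) := by
  unfold DVPDAInstance.pairEq
  fun_prop

@[fun_prop]
theorem statePairs {l : α → List ℕ} (hl : PolyTime l) : PolyTime fun a => statePairs (l a) := by
  unfold DVPDAInstance.statePairs
  fun_prop

@[fun_prop]
theorem derives {l : α → List ℕ} {T : α → List (Bool × (ℕ × ℕ) × (ℕ × ℕ))}
    {x : α → Bool × (ℕ × ℕ) × (ℕ × ℕ)} (hl : PolyTime l) (hT : PolyTime T) (hx : PolyTime x) :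
    PolyTime fun a => derives (l a) (T a) (x a) := by
  unfold DVPDAInstance.derives
  fun_prop

@[fun_prop]
theorem table {l : α → List ℕ} (hl : PolyTime l) : PolyTime fun a => table (l a) := by
  unfold DVPDAInstance.table transitions
  fun_prop

@[fun_prop]
theorem accepts {l : α → List ℕ} (hl : PolyTime l) : PolyTime fun a => accepts (l a) := by
  unfold DVPDAInstance.accepts
  fun_prop

@[fun_prop]
theorem valid {l : α → List ℕ} (hl : PolyTime l) : PolyTime fun a => valid (l a) := by
  unfold DVPDAInstance.valid
  fun_prop

@[fun_prop]
theorem parse : PolyTime parse := by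
  refine foldl_of_le (L := fun x => x) (I := fun _ => (0, []))
    (F := fun _ s b => bif b then (s.1 + 1, s.2) else (0, s.1 :: s.2)) .id (const _)
    (by fun_prop) ⟨2, fun a s b => ?_⟩
  obtain ⟨m, l⟩ := s
  cases b
  · simp only [cond_false, esize_pair, esize_cons, Polynomial.eval_ofNat]
    have : esize 0 = 1 := rfl
    omega
  · simp only [cond_true, esize_pair, esize_nat, Polynomial.eval_ofNat]
    omega

theorem decision : PolyTime decision := by
  unfold DVPDAInstance.decision
  fun_prop

end PolyTime

/-! ### Lists of numbers that describe an instance. -/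

namespace DVPDAInstance

/-- The number of a stack symbol. -/
def symbolIndex {g : ℕ} : WithBot (Fin g) → ℕ :=
  WithBot.recBotCoe 0 fun γ => γ + 1

theorem symbolIndex_lt {g : ℕ} (γ : WithBot (Fin g)) : symbolIndex γ < g + 1 := by
  induction γ using WithBot.recBotCoe with
  | bot => exact Nat.succ_pos g
  | coe γ => exact Nat.succ_lt_succ γ.2

/-- The list of numbers describes the instance. -/
structure Describes (l : List ℕ) (X : DVPDAInstance) : Prop where
  n : entry l 0 = X.n
  c : entry l 1 = X.c
  i : entry l 2 = X.i
  r : entry l 3 = X.r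
  g : entry l 4 = X.g
  length : l.length = 5 + (X.n * (X.c * 2) + (X.n * X.i + X.n * (X.r * (X.g + 1))))
  callState_eq : ∀ (q : Fin X.n) (a : Fin X.c), callState l q a = (X.M.δc q a).1
  callSymbol_eq : ∀ (q : Fin X.n) (a : Fin X.c), callSymbol l q a = (X.M.δc q a).2
  intState_eq : ∀ (q : Fin X.n) (a : Fin X.i), intState l q a = X.M.δi q a
  retState_eq : ∀ (q : Fin X.n) (a : Fin X.r) (γ : WithBot (Fin X.g)), retState l q a (symbolIndex γ) = X.M.δr q a γ

theorem exists_eq_mul_add {m n k : ℕ} (h : m < n * k) : ∃ q < n, ∃ j < k, m = q * k + j := by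
  have hk : 0 < k := Nat.pos_of_ne_zero fun hk => by simp [hk] at h
  exact ⟨m / k, Nat.div_lt_of_lt_mul (by rwa [mul_comm]), m % k, Nat.mod_lt _ hk, by
    rw [mul_comm, Nat.div_add_mod]⟩

/-- Every position belongs to the header or to one of the three tables, and division with remainder
recovers the arguments of its entry. Thus a list that passes `valid` is the canonical list of its
automaton. -/
theorem Describes.unique {l l' : List ℕ} {X : DVPDAInstance} (h : Describes l X)
    (h' : Describes l' X) : l = l' := by
  refine List.ext_getElem (h.length.trans h'.length.symm) fun k hk hk' => ?_
  rw [← List.getD_eq_getElem l 0 hk, ← List.getD_eq_getElem l' 0 hk']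
  rw [h.length] at hk
  by_cases hk5 : k < 5
  · interval_cases k
    · exact h.n.trans h'.n.symm
    · exact h.c.trans h'.c.symm
    · exact h.i.trans h'.i.symm
    · exact h.r.trans h'.r.symm
    · exact h.g.trans h'.g.symm
  obtain ⟨k, rfl⟩ := Nat.exists_eq_add_of_le (not_lt.1 hk5)
  replace hk := Nat.lt_of_add_lt_add_left hk
  by_cases hkc : k < X.n * (X.c * 2)
  · obtain ⟨q, hq, j, hj, rfl⟩ := exists_eq_mul_add hkc
    obtain ⟨a, ha, e, he, rfl⟩ := exists_eq_mul_add hj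
    rw [show q * (X.c * 2) + (a * 2 + e) = (q * X.c + a) * 2 + e by ring]
    interval_cases e
    · have := (h.callState_eq ⟨q, hq⟩ ⟨a, ha⟩).trans (h'.callState_eq ⟨q, hq⟩ ⟨a, ha⟩).symm
      simpa only [DVPDAInstance.callState, h.c, h'.c, add_zero] using this
    · have := (h.callSymbol_eq ⟨q, hq⟩ ⟨a, ha⟩).trans (h'.callSymbol_eq ⟨q, hq⟩ ⟨a, ha⟩).symm
      simpa only [DVPDAInstance.callSymbol, h.c, h'.c] using this
  obtain ⟨k, rfl⟩ := Nat.exists_eq_add_of_le (not_lt.1 hkc)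
  replace hk := Nat.lt_of_add_lt_add_left hk
  by_cases hki : k < X.n * X.i
  · obtain ⟨q, hq, a, ha, rfl⟩ := exists_eq_mul_add hki
    have := (h.intState_eq ⟨q, hq⟩ ⟨a, ha⟩).trans (h'.intState_eq ⟨q, hq⟩ ⟨a, ha⟩).symm
    simpa only [DVPDAInstance.intState, h.n, h.c, h.i, h'.n, h'.c, h'.i] using this
  obtain ⟨k, rfl⟩ := Nat.exists_eq_add_of_le (not_lt.1 hki)
  replace hk := Nat.lt_of_add_lt_add_left hk
  obtain ⟨q, hq, j, hj, rfl⟩ := exists_eq_mul_add hk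
  obtain ⟨a, ha, e, he, rfl⟩ := exists_eq_mul_add hj
  rw [show q * (X.r * (X.g + 1)) + (a * (X.g + 1) + e) = (q * X.r + a) * (X.g + 1) + e by ring]
  obtain ⟨γ, rfl⟩ : ∃ γ : WithBot (Fin X.g), symbolIndex γ = e := by
    rcases e with _ | e
    · exact ⟨⊥, rfl⟩
    · exact ⟨(⟨e, Nat.lt_of_succ_lt_succ he⟩ : Fin X.g), rfl⟩
  have := (h.retState_eq ⟨q, hq⟩ ⟨a, ha⟩ γ).trans (h'.retState_eq ⟨q, hq⟩ ⟨a, ha⟩ γ).symm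
  simpa only [DVPDAInstance.retState, h.n, h.c, h.i, h.r, h.g, h'.n, h'.c, h'.i, h'.r, h'.g]
    using this

theorem length_flatMap_finRange {n k : ℕ} (f : Fin n → List ℕ) (h : ∀ q, (f q).length = k) :
    ((List.finRange n).flatMap f).length = n * k := by
  simp [List.length_flatMap, h]

theorem getD_flatMap_finRange {n k : ℕ} (f : Fin n → List ℕ) (h : ∀ q, (f q).length = k)
    (q : Fin n) {j : ℕ} (hj : j < k) :
    ((List.finRange n).flatMap f).getD (q * k + j) 0 = (f q).getD j 0 := by
  induction n with
  | zero => exact q.elim0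
  | succ n ih =>
    rw [List.finRange_succ, List.flatMap_cons]
    refine Fin.cases ?_ (fun q => ?_) q
    · rw [Fin.val_zero, zero_mul, zero_add, List.getD_append _ _ _ _ (by rw [h]; exact hj)]
    · rw [Fin.val_succ, List.getD_append_right _ _ _ _ (by rw [h]; nlinarith), h,
        show (q.1 + 1) * k + j - k = q * k + j by rw [add_mul]; omega, List.flatMap_map]
      exact ih (fun q => f q.succ) (fun q => h q.succ) q

theorem getD_append_add {l : List ℕ} {m : ℕ} (h : l.length = m) (l' : List ℕ) (k : ℕ) :
    (l ++ l').getD (m + k) 0 = l'.getD k 0 := by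
  rw [List.getD_append_right _ _ _ _ (by omega)]
  congr 1
  omega

theorem describes_toNats (X : DVPDAInstance) : Describes X.toNats X := by
  have hc₁ : ∀ q, ((List.finRange X.c).flatMap fun a =>
      [((X.M.δc q a).1 : ℕ), ((X.M.δc q a).2 : ℕ)]).length = X.c * 2 := fun q =>
    length_flatMap_finRange _ fun _ => rfl
  have hi₁ : ∀ q, ((List.finRange X.i).flatMap fun a => [(X.M.δi q a : ℕ)]).length = X.i := fun q =>
    (length_flatMap_finRange (k := 1) _ fun _ => rfl).trans (mul_one _)
  have hr₂ : ∀ q a, ((X.M.δr q a ⊥ : ℕ) :: (List.finRange X.g).map fun γ =>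
      (X.M.δr q a (γ : WithBot (Fin X.g)) : ℕ)).length = X.g + 1 := fun q a => by simp
  have hr₁ : ∀ q, ((List.finRange X.r).flatMap fun a => (X.M.δr q a ⊥ : ℕ) ::
      (List.finRange X.g).map fun γ => (X.M.δr q a (γ : WithBot (Fin X.g)) : ℕ)).length =
      X.r * (X.g + 1) := fun q => length_flatMap_finRange _ (hr₂ q)
  have h₅ : [X.n, X.c, X.i, X.r, X.g].length = 5 := rfl
  have hc := length_flatMap_finRange _ hc₁
  have hi := length_flatMap_finRange _ hi₁
  have hr := length_flatMap_finRange _ hr₁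
  refine ⟨rfl, rfl, rfl, rfl, rfl, ?_, fun q a => ?_, fun q a => ?_, fun q a => ?_,
    fun q a γ => ?_⟩
  · rw [toNats, List.length_append, List.length_append, List.length_append, hc, hi, hr]
    simp only [List.length_cons, List.length_nil]
    ring
  · change X.toNats.getD (5 + (q * X.c + a) * 2) 0 = _
    rw [toNats, List.append_assoc, List.append_assoc, getD_append_add h₅,
      show (q.1 * X.c + a) * 2 = q * (X.c * 2) + (a * 2 + 0) by ring,
      List.getD_append _ _ _ _ (by rw [hc]; nlinarith [q.2, a.2]),
      getD_flatMap_finRange _ hc₁ q (by omega),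
      getD_flatMap_finRange (k := 2) _ (fun _ => rfl) a (by simp)]
    rfl
  · change X.toNats.getD (5 + ((q * X.c + a) * 2 + 1)) 0 = _
    rw [toNats, List.append_assoc, List.append_assoc, getD_append_add h₅,
      show (q.1 * X.c + a) * 2 + 1 = q * (X.c * 2) + (a * 2 + 1) by ring,
      List.getD_append _ _ _ _ (by rw [hc]; nlinarith [q.2, a.2]),
      getD_flatMap_finRange _ hc₁ q (by omega),
      getD_flatMap_finRange (k := 2) _ (fun _ => rfl) a (by simp)]
    rfl
  · change X.toNats.getD (5 + (X.n * (X.c * 2) + (q * X.i + a))) 0 = _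
    rw [toNats, List.append_assoc, List.append_assoc, getD_append_add h₅, getD_append_add hc,
      List.getD_append _ _ _ _ (by rw [hi]; nlinarith [q.2, a.2]),
      getD_flatMap_finRange _ hi₁ q a.2, show a.1 = a * 1 + 0 by ring,
      getD_flatMap_finRange (k := 1) _ (fun _ => rfl) a (by simp)]
    rfl
  · change X.toNats.getD (5 + (X.n * (X.c * 2) + (X.n * X.i +
      ((q * X.r + a) * (X.g + 1) + symbolIndex γ)))) 0 = _
    have hγ := symbolIndex_lt γ
    rw [toNats, List.append_assoc, List.append_assoc, getD_append_add h₅, getD_append_add hc,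
      getD_append_add hi, show (q.1 * X.r + a) * (X.g + 1) + symbolIndex γ =
        q * (X.r * (X.g + 1)) + (a * (X.g + 1) + symbolIndex γ) by ring,
      getD_flatMap_finRange _ hr₁ q (by nlinarith [a.2]), getD_flatMap_finRange _ (hr₂ q) a hγ]
    induction γ using WithBot.recBotCoe with
    | bot => rfl
    | coe γ =>
      change (List.map _ _).getD γ.1 0 = _
      simp [← List.map_eq_flatMap]

theorem Describes.valid {l : List ℕ} {X : DVPDAInstance} (h : Describes l X) (hr : 0 < X.r) :
    valid l = true := by
  simp only [DVPDAInstance.valid, h.n, h.c, h.i, h.r, h.g, h.length, Bool.and_eq_true,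
    decide_eq_true_eq, List.all_eq_true, List.mem_range]
  refine ⟨⟨⟨X.n_pos, hr⟩, trivial⟩, fun q hq => ⟨⟨fun a ha => ?_, fun a ha => ?_⟩,
    fun a ha γ hγ => ?_⟩⟩
  · rw [h.callState_eq ⟨q, hq⟩ ⟨a, ha⟩, h.callSymbol_eq ⟨q, hq⟩ ⟨a, ha⟩]
    exact ⟨Fin.is_lt _, Fin.is_lt _⟩
  · rw [h.intState_eq ⟨q, hq⟩ ⟨a, ha⟩]
    exact Fin.is_lt _
  · rcases γ with _ | γ
    · rw [show 0 = symbolIndex (⊥ : WithBot (Fin X.g)) from rfl, h.retState_eq ⟨q, hq⟩ ⟨a, ha⟩]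
      exact Fin.is_lt _
    · have := h.retState_eq ⟨q, hq⟩ ⟨a, ha⟩ (⟨γ, Nat.lt_of_succ_lt_succ hγ⟩ : Fin X.g)
      exact this.trans_lt (Fin.is_lt _)

theorem exists_describes {l : List ℕ} (h : valid l = true) :
    ∃ X : DVPDAInstance, 0 < X.r ∧ Describes l X := by
  simp only [valid, Bool.and_eq_true, decide_eq_true_eq, List.all_eq_true, List.mem_range] at h
  obtain ⟨⟨⟨hn, hr⟩, hlen⟩, h⟩ := h
  exact ⟨⟨entry l 0, entry l 1, entry l 2, entry l 3, entry l 4, hn,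
    fun q a => (⟨callState l q a, ((h q q.2).1.1 a a.2).1⟩,
      ⟨callSymbol l q a, ((h q q.2).1.1 a a.2).2⟩),
    fun q a => ⟨intState l q a, (h q q.2).1.2 a a.2⟩,
    fun q a γ => ⟨retState l q a (symbolIndex γ), (h q q.2).2 a a.2 _ (symbolIndex_lt γ)⟩⟩,
    hr, rfl, rfl, rfl, rfl, rfl, hlen, fun _ _ => rfl, fun _ _ => rfl, fun _ _ => rfl,
    fun _ _ _ => rfl⟩

/-! ### Correctness of the table -/

theorem pairEq_iff {x y : ℕ × ℕ} : pairEq x y = true ↔ x = y := by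
  simp [pairEq, Prod.ext_iff]

/-- The table occurs only positively in the rules. -/
theorem derives_mono {l : List ℕ} (T T' : List (Bool × (ℕ × ℕ) × (ℕ × ℕ)))
    (x : Bool × (ℕ × ℕ) × (ℕ × ℕ)) (hT : T ⊆ T') (h : derives l T x = true) :
    derives l T' x = true := by
  simp only [derives, Bool.or_eq_true, List.any_eq_true] at h ⊢
  rcases h with (h | ⟨y, hy, z, hz, h⟩) | ⟨a, ha, b, hb, y, hy, h⟩
  · exact .inl (.inl h)
  · exact .inl (.inr ⟨y, hT hy, z, hT hz, h⟩)
  · exact .inr ⟨a, ha, b, hb, y, hT hy, h⟩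

/-- The numbers of a pair of states. -/
def pairVal {n : ℕ} (p : Fin n × Fin n) : ℕ × ℕ := (p.1, p.2)

theorem pairVal_injective {n : ℕ} : Function.Injective (pairVal (n := n)) := fun p q h => by
  simp only [pairVal, Prod.mk.injEq] at h
  exact Prod.ext (Fin.ext h.1) (Fin.ext h.2)

section Describes

variable {l : List ℕ} {X : DVPDAInstance}

theorem Describes.mem_statePairs (h : Describes l X) {x : ℕ × ℕ} :
    x ∈ statePairs l ↔ ∃ p : Fin X.n × Fin X.n, pairVal p = x := by
  rw [statePairs, h.n, List.mem_product, List.mem_range, List.mem_range]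
  constructor
  · rintro ⟨h₁, h₂⟩
    exact ⟨(⟨x.1, h₁⟩, ⟨x.2, h₂⟩), rfl⟩
  · rintro ⟨p, rfl⟩
    exact ⟨p.1.2, p.2.2⟩

theorem Describes.mem_transitions (h : Describes l X) {x : Bool × (ℕ × ℕ) × (ℕ × ℕ)} :
    x ∈ transitions l ↔ ∃ e, ∃ p q : Fin X.n × Fin X.n, x = (e, pairVal p, pairVal q) := by
  obtain ⟨e, x, y⟩ := x
  rw [transitions, List.mem_product, List.mem_product, h.mem_statePairs, h.mem_statePairs]
  constructor
  · rintro ⟨-, ⟨p, rfl⟩, q, rfl⟩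
    exact ⟨e, p, q, rfl⟩
  · rintro ⟨e', p, q, h⟩
    simp only [Prod.mk.injEq] at h
    obtain ⟨rfl, rfl, rfl⟩ := h
    exact ⟨by cases e <;> simp, ⟨p, rfl⟩, q, rfl⟩

/-- The intermediate `x` remains a pair of plain numbers, because an arbitrary `T` may contain
numbers that are not states. -/
theorem Describes.derives_iff (h : Describes l X) (T : List (Bool × (ℕ × ℕ) × (ℕ × ℕ))) (e : Bool)
    (p q : Fin X.n × Fin X.n) : derives l T (e, pairVal p, pairVal q) = true ↔
      p = q ∨ (∃ a, q = (X.M.δi p.1 a, X.M.δi p.2 a)) ∨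
      (e = false ∧ ∃ b, q = (X.M.δr p.1 b ⊥, X.M.δr p.2 b ⊥)) ∨
      (∃ x, (e, pairVal p, x) ∈ T ∧ (e, x, pairVal q) ∈ T) ∨
      ∃ (a : Fin X.c) (b : Fin X.r) (x : ℕ × ℕ),
        (true, pairVal ((X.M.δc p.1 a).1, (X.M.δc p.2 a).1), x) ∈ T ∧ pairVal q =
        (retState l x.1 b (symbolIndex ((X.M.δc p.1 a).2 : WithBot (Fin X.g))),
          retState l x.2 b (symbolIndex ((X.M.δc p.2 a).2 : WithBot (Fin X.g)))) := by
  have h₁ : (∃ a < X.i, pairVal q = (intState l p.1 a, intState l p.2 a)) ↔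
      ∃ a, q = (X.M.δi p.1 a, X.M.δi p.2 a) := by
    rw [Fin.exists_iff]
    refine exists_congr fun a => ⟨fun ⟨ha, hq⟩ => ⟨ha, ?_⟩, fun ⟨ha, hq⟩ => ⟨ha, ?_⟩⟩
    · rw [h.intState_eq p.1 ⟨a, ha⟩, h.intState_eq p.2 ⟨a, ha⟩] at hq
      exact pairVal_injective hq
    · rw [h.intState_eq p.1 ⟨a, ha⟩, h.intState_eq p.2 ⟨a, ha⟩, hq]
      rfl
  have h₂ : (∃ b < X.r, pairVal q = (retState l p.1 b 0, retState l p.2 b 0)) ↔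
      ∃ b, q = (X.M.δr p.1 b ⊥, X.M.δr p.2 b ⊥) := by
    rw [Fin.exists_iff]
    refine exists_congr fun b => ⟨fun ⟨hb, hq⟩ => ⟨hb, ?_⟩, fun ⟨hb, hq⟩ => ⟨hb, ?_⟩⟩
    · have := (h.retState_eq p.1 ⟨b, hb⟩ ⊥)
      have := (h.retState_eq p.2 ⟨b, hb⟩ ⊥)
      simp_all [symbolIndex]
      exact pairVal_injective hq
    · have := (h.retState_eq p.1 ⟨b, hb⟩ ⊥)
      have := (h.retState_eq p.2 ⟨b, hb⟩ ⊥)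
      simp_all [symbolIndex]
      rfl
  have h₃ : (∃ y ∈ T, ∃ z ∈ T, e = y.1 ∧ e = z.1 ∧ y.2.1 = pairVal p ∧ y.2.2 = z.2.1 ∧
      z.2.2 = pairVal q) ↔ ∃ x, (e, pairVal p, x) ∈ T ∧ (e, x, pairVal q) ∈ T := by
    constructor
    · rintro ⟨⟨_, _, x⟩, hy, ⟨_, _, _⟩, hz, rfl, rfl, rfl, rfl, rfl⟩
      exact ⟨x, hy, hz⟩
    · rintro ⟨x, hy, hz⟩
      exact ⟨_, hy, _, hz, rfl, rfl, rfl, rfl, rfl⟩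
  have h₄ : (∃ a < X.c, ∃ b < X.r, ∃ y ∈ T, y.1 = true ∧
      y.2.1 = (callState l p.1 a, callState l p.2 a) ∧
      pairVal q = (retState l y.2.2.1 b (callSymbol l p.1 a + 1),
        retState l y.2.2.2 b (callSymbol l p.2 a + 1))) ↔
      ∃ (a : Fin X.c) (b : Fin X.r) (x : ℕ × ℕ),
        (true, pairVal ((X.M.δc p.1 a).1, (X.M.δc p.2 a).1), x) ∈ T ∧ pairVal q =
        (retState l x.1 b (symbolIndex ((X.M.δc p.1 a).2 : WithBot (Fin X.g))),
          retState l x.2 b (symbolIndex ((X.M.δc p.2 a).2 : WithBot (Fin X.g)))) := by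
    constructor
    · rintro ⟨a, ha, b, hb, ⟨_, _, x⟩, hy, rfl, rfl, hq⟩
      refine ⟨⟨a, ha⟩, ⟨b, hb⟩, x, ?_, ?_⟩
      · rw [h.callState_eq p.1 ⟨a, ha⟩, h.callState_eq p.2 ⟨a, ha⟩] at hy
        exact hy
      · rw [h.callSymbol_eq p.1 ⟨a, ha⟩, h.callSymbol_eq p.2 ⟨a, ha⟩] at hq
        exact hq
    · rintro ⟨a, b, x, hy, hq⟩
      refine ⟨a, a.2, b, b.2, _, hy, rfl, ?_, ?_⟩
      · rw [h.callState_eq p.1 a, h.callState_eq p.2 a]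
        rfl
      · rw [h.callSymbol_eq p.1 a, h.callSymbol_eq p.2 a]
        exact hq
  have hxor : ∀ a b : Bool, (a ^^ b) = false ↔ a = b := by decide
  rw [← h₁, ← h₂, ← h₃, ← h₄, ← pairVal_injective.eq_iff]
  simp only [derives, h.i, h.r, h.c, Bool.or_eq_true, Bool.and_eq_true, List.any_eq_true,
    List.mem_range, pairEq_iff, Bool.not_eq_true', hxor, or_assoc, and_assoc]
  rfl

/-- Soundness holds stage by stage; completeness is an induction on `Reach`, as the saturated table
is closed under each rule. -/
theorem Describes.mem_table (h : Describes l X) {e : Bool} {p q : Fin X.n × Fin X.n} :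
    (e, pairVal p, pairVal q) ∈ table l ↔ X.M.Reach e p q := by
  constructor
  · intro hx
    suffices ∀ x ∈ table l, ∃ e, ∃ p q : Fin X.n × Fin X.n,
        x = (e, pairVal p, pairVal q) ∧ X.M.Reach e p q by
      obtain ⟨e', p', q', heq, hR⟩ := this _ hx
      simp only [Prod.mk.injEq, pairVal_injective.eq_iff] at heq
      obtain ⟨rfl, rfl, rfl⟩ := heq
      exact hR
    refine saturate_induction fun T x hT hx hφ => ?_
    obtain ⟨e, p, q, rfl⟩ := h.mem_transitions.1 hx
    refine ⟨e, p, q, rfl, ?_⟩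
    have hT' : ∀ {e x y}, (e, x, y) ∈ T → ∃ p q : Fin X.n × Fin X.n,
        x = pairVal p ∧ y = pairVal q ∧ X.M.Reach e p q := by
      intro e x y hxy
      obtain ⟨e', p, q, heq, hR⟩ := hT _ hxy
      simp only [Prod.mk.injEq] at heq
      obtain ⟨rfl, rfl, rfl⟩ := heq
      exact ⟨p, q, rfl, rfl, hR⟩
    rcases (h.derives_iff T e p q).1 hφ with rfl | ⟨a, rfl⟩ | ⟨rfl, b, rfl⟩ | ⟨x, h₁, h₂⟩ |
      ⟨a, b, x, h₁, hq⟩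
    · exact .refl _ _
    · exact .int _ _ _
    · exact .bot _ _
    · obtain ⟨p₁, q₁, hp₁, rfl, hR₁⟩ := hT' h₁
      obtain ⟨p₂, q₂, hp₂, hq₂, hR₂⟩ := hT' h₂
      obtain rfl := pairVal_injective hp₁
      obtain rfl := pairVal_injective hp₂
      obtain rfl := pairVal_injective hq₂
      exact hR₁.trans hR₂
    · obtain ⟨p₁, q₁, hp₁, rfl, hR₁⟩ := hT' h₁
      obtain rfl := pairVal_injective hp₁
      have := h.retState_eq q₁.1 b (X.M.δc p.1 a).2
      have h' := h.retState_eq q₁.2 b (X.M.δc p.2 a).2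
      simp only [pairVal] at hq
      rw [this, h'] at hq
      obtain rfl : q = (_, _) := pairVal_injective hq
      exact .nest _ _ _ _ hR₁
  · intro hR
    induction hR with
    | refl e p =>
      exact mem_saturate derives_mono (h.mem_transitions.2 ⟨_, _, _, rfl⟩)
        ((h.derives_iff _ _ _ _).2 (.inl rfl))
    | int e p a =>
      exact mem_saturate derives_mono (h.mem_transitions.2 ⟨_, _, _, rfl⟩)
        ((h.derives_iff _ _ _ _).2 (.inr (.inl ⟨a, rfl⟩)))
    | bot p b =>
      exact mem_saturate derives_mono (h.mem_transitions.2 ⟨_, _, _, rfl⟩)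
        ((h.derives_iff _ _ _ _).2 (.inr (.inr (.inl ⟨rfl, b, rfl⟩))))
    | trans _ _ ih₁ ih₂ =>
      exact mem_saturate derives_mono (h.mem_transitions.2 ⟨_, _, _, rfl⟩)
        ((h.derives_iff _ _ _ _).2 (.inr (.inr (.inr (.inl ⟨_, ih₁, ih₂⟩)))))
    | nest e p a b _ ih =>
      refine mem_saturate derives_mono (h.mem_transitions.2 ⟨_, _, _, rfl⟩)
        ((h.derives_iff _ _ _ _).2 (.inr (.inr (.inr (.inr ⟨a, b, _, ih, ?_⟩)))))
      rw [pairVal, pairVal, h.retState_eq, h.retState_eq]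

theorem Describes.accepts_iff (h : Describes l X) :
    accepts l = true ↔ ∀ p : Fin X.n × Fin X.n, ∃ q, X.M.Reach false p (q, q) := by
  simp only [accepts, List.all_eq_true, List.any_eq_true, h.mem_statePairs, List.mem_range, h.n,
    Bool.and_eq_true, Bool.not_eq_true', pairEq_iff, forall_exists_index,
    forall_apply_eq_imp_iff]
  refine forall_congr' fun p => ?_
  rw [Fin.exists_iff]
  refine exists_congr fun q => ⟨?_, ?_⟩
  · rintro ⟨hq, ⟨e, x, y⟩, hy, ⟨rfl, rfl⟩, rfl⟩
    exact ⟨hq, h.mem_table.1 hy⟩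
  · rintro ⟨hq, hR⟩
    exact ⟨hq, _, h.mem_table.2 hR, ⟨rfl, rfl⟩, rfl⟩

end Describes

/-! ### Correctness of the decision procedure -/

theorem encodeNats_append (l l' : List ℕ) :
    encodeNats (l ++ l') = encodeNats l ++ encodeNats l' :=
  List.flatMap_append

theorem encodeNats_singleton (m : ℕ) : encodeNats [m] = List.replicate m true ++ [false] := by
  simp [encodeNats]

/-- Only an unfinished block of ones can remain, hence the test `(parse x).1 = 0` in `decision`. -/
theorem eq_encodeNats_parse (x : List Bool) :
    x = encodeNats (parse x).2.reverse ++ List.replicate (parse x).1 true := by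
  induction x using List.reverseRecOn with
  | nil => rfl
  | append_singleton x b ih =>
    have h : parse (x ++ [b]) = bif b then ((parse x).1 + 1, (parse x).2)
        else (0, (parse x).1 :: (parse x).2) := by
      rw [parse, List.foldl_append]
      rfl
    cases b
    · rw [h]
      conv_lhs => rw [ih]
      simp [encodeNats_append, encodeNats_singleton]
    · rw [h]
      conv_lhs => rw [ih]
      simp [List.replicate_succ']

theorem parse_encodeNats (l : List ℕ) : parse (encodeNats l) = (0, l.reverse) := by
  have h : ∀ (m k : ℕ) (s : List ℕ),
      (List.replicate m true).foldl (fun (s : ℕ × List ℕ) b =>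
        bif b then (s.1 + 1, s.2) else (0, s.1 :: s.2)) (k, s) = (k + m, s) := by
    intro m
    induction m with
    | zero => intro k s; rfl
    | succ m ih => intro k s; rw [List.replicate_succ, List.foldl_cons, cond_true, ih]; congr 1; omega
  induction l using List.reverseRecOn with
  | nil => rfl
  | append_singleton l m ih =>
    rw [parse] at ih ⊢
    rw [encodeNats_append, encodeNats_singleton, List.foldl_append, List.foldl_append, ih, h]
    simp

theorem decision_iff (x : List Bool) : decision x = true ↔ x ∈ SyncDVPDASameReturn := by
  have key : ∀ X : DVPDAInstance, 0 < X.r → ∀ l, Describes l X →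
      (accepts l = true ↔ ∃ w, X.M.SyncSame w) := by
    intro X hr l h
    have : Nonempty (Fin X.r) := ⟨⟨0, hr⟩⟩
    have : Nonempty (Fin X.n) := ⟨⟨0, X.n_pos⟩⟩
    rw [X.M.exists_syncSame_iff_exists_syncEmpty, DVPDA.exists_syncEmpty_iff, h.accepts_iff]
  rw [decision, Bool.and_eq_true, Bool.and_eq_true, decide_eq_true_eq]
  constructor
  · rintro ⟨h₀, hv, ha⟩
    obtain ⟨X, hr, hX⟩ := exists_describes hv
    refine ⟨X, hr, (key X hr _ hX).1 ha, ?_⟩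
    -- Uniqueness turns the description found by parsing into the encoding itself.
    rw [encode, ← hX.unique X.describes_toNats]
    simpa [h₀] using eq_encodeNats_parse x
  · rintro ⟨X, hr, hw, rfl⟩
    rw [encode, parse_encodeNats, List.reverse_reverse]
    exact ⟨rfl, X.describes_toNats.valid hr, (key X hr _ X.describes_toNats).2 hw⟩

end DVPDAInstance

theorem mainTheorem5 :
    SyncDVPDASameReturn ∈ PTIME ∧
    ∀ (Q C I R G : Type) [Finite Q] [Nonempty Q] [Finite C] [Finite I] [Finite R] [Finite G]
      (M : DVPDA Q C I R G), Nonempty R →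
      ((∃ w, M.SyncSame w) ↔ (∃ w, M.SyncEmpty w)) :=
  ⟨⟨DVPDAInstance.decision, DVPDAInstance.decision_iff,
    PolyTime.decision.nonempty_computableInPolyTime⟩,
    fun _ _ _ _ _ _ _ _ _ _ _ M _ => M.exists_syncSame_iff_exists_syncEmpty⟩
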